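/- All Lie algebras are over $\mathbb{C}$, and $r\wedge s$ denotes the greatest common divisor of $r$ and $s$. The index of a finite-dimensional Lie algebra $\mathfrak{g}$ is $\chi[\mathfrak{g}]=\min_{f\in\mathfrak{g}^*}\dim\mathfrak{g}_f$, where $\mathfrak{g}_f=\{x\in\mathfrak{g} : f([x,y])=0 \text{ for all } y\in\mathfrak{g}\}$. For positive integers $a,b,c,d$ and $n=a+b+c+d$, let $\mathfrak{p}(a,b,c,d)\subseteq\mathfrak{gl}(n)$ be the parabolic subalgebra of block upper triangular matrices whose diagonal blocks have sizes $a,b,c,d$, in this order. Theorem. Let $a,b,c,d$ be positive integers. 1. If $(a+b+c)\wedge(b+c+d)\ge b+c$, then $\chi[\mathfrak{p}(a,b,c,d)]=[(a+b+c)\wedge(b+c+d)]-(b+c)+(b\wedge c)$. 2. If $(a+b+c)\wedge(c+d)\ge a+b$, then $\chi[\mathfrak{p}(a,b,c,d)]=[(a+b+c)\wedge(c+d)]-(a+b)+(a\wedge b)$. 3. If $(a+b)\wedge(b+c+d)\ge c+d$, then $\chi[\mathfrak{p}(a,b,c,d)]=[(a+b)\wedge(b+c+d)]-(c+d)+(c\wedge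 d)$. 4. If $a>d$ and $(b+a-d)\wedge(b+c)\ge a-d$, then $\chi[\mathfrak{p}(a,b,c,d)]=[(b+a-d)\wedge(b+c)]-(a-d)+(a\wedge d)$. -/

import Mathlib

/-- The stabilizer `L_f = {x ∈ L | f([x, y]) = 0 for all y ∈ L}` of a linear form `f` on a
Lie algebra `L`, for the coadjoint action. -/
def coadjointStabilizer (K : Type*) {L : Type*} [Field K] [LieRing L] [LieAlgebra K L]
    (f : Module.Dual K L) : Submodule K L where
  carrier := {x | ∀ y : L, f ⁅x, y⁆ = 0}
  zero_mem' := by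
    intro y
    simp
  add_mem' := by
    intro x z hx hz y
    simp [hx y, hz y]
  smul_mem' := by
    intro t x hx y
    simp [hx y]

/-- The index of a finite-dimensional Lie algebra `L`: the least dimension of the stabilizer
`L_f`, for `f` in the dual of `L`. The set of these dimensions is a non-empty set of natural
numbers, so that its infimum is its minimum. -/
noncomputable def lieIndex (K L : Type*) [Field K] [LieRing L] [LieAlgebra K L]
    [FiniteDimensional K L] : ℕ :=
  sInf (Set.range fun f : Module.Dual K L => Module.finrank K (coadjointStabilizer K f))

attribute [local instance 100] LieRing.ofAssociativeRing

/-- The standard parabolic subalgebra `𝔭(a₁, …, a_k)` of `𝔤𝔩(n)` over the complex numbers attached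
to the composition `(a₁, …, a_k)` of `n`: the block upper triangular matrices whose diagonal
blocks have the sizes `a₁, …, a_k`, in this order, with the commutator bracket (`κ.index i` is the number of the block that
contains `i`). -/
def parabolicSubalgebra {n : ℕ} (κ : Composition n) :
    LieSubalgebra ℂ (Matrix (Fin n) (Fin n) ℂ) where
  carrier := {M | M.BlockTriangular κ.index}
  zero_mem' := Matrix.blockTriangular_zero
  add_mem' := fun hM hN => hM.add hN
  smul_mem' := by
    intro t M hM i j hij
    simp [hM hij]
  lie_mem' := by
    intro M N hM hN
    rw [Set.mem_ofPred_eq, Ring.lie_def]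
    exact (hM.mul hN).sub (hN.mul hM)

/-! The index is computed from a single form with a toral stabilizer. Every form on the parabolic is
`x ↦ tr(A x)`, and only the part of `A` on and below the block diagonal matters. Its stabilizer
consists of the block upper triangular `x` for which `[x, A]` vanishes on and below the block
diagonal. Suppose that these `x` are exactly the diagonal matrices constant on the classes of a
colouring with which `A` itself is compatible. By the inverse function theorem every form near `A`
is conjugate, under the block triangular group, to some `A + τ` with `τ` compatible with the
colouring, so it is stabilized by a conjugate of the same torus. Nearby forms therefore have
stabilizers at least as large as that of `A`. Since small perturbations in the direction of any
given form have generically no larger a stabilizer than that form, the number of colours is the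
index (`lieIndex_eq_card`).

It remains to find such matrices. Group some indices into one block `M` and ask for a matrix on the
resulting three blocks whose symmetries are torally rigid as soon as the `M`-component of the
symmetry is diagonal. Such matrices are built by reversing Euclid's algorithm: an arrow that is an
inclusion or a projection reduces the linear group of a large block to a parabolic, and the problem
becomes the same one for smaller sizes (`exists_isMid`, `exists_isPair`). The hypothesis `gcd ≥ |M|`
makes the algorithm stop with `gcd - |M|` free colours. The construction also shows that the
remaining blocks contribute nothing to the equation at `M`. So a toral matrix for two blocks, with
as many colours as the gcd of their sizes (`exists_isTwo`), can be inserted at `M`, and the colour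
counts add up to the formula. -/

open Filter Topology Matrix

/-! ### Semicontinuity of the dimension of coadjoint stabilizers -/

/-- The map `L → L*`, `x ↦ f([x, ·])`, whose kernel is the stabilizer of `f`. -/
def coadjointMap (K : Type*) {L : Type*} [Field K] [LieRing L] [LieAlgebra K L] :
    Module.Dual K L →ₗ[K] L →ₗ[K] Module.Dual K L where
  toFun f :=
    { toFun := fun x => f ∘ₗ (LieAlgebra.ad K L x : L →ₗ[K] L)
      map_add' := by intro x y; ext z; simp
      map_smul' := by intro t x; ext z; simp }
  map_add' := by intro f g; ext x y; simp
  map_smul' := by intro t f; ext x y; simp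

theorem ker_coadjointMap {K L : Type*} [Field K] [LieRing L] [LieAlgebra K L]
    (f : Module.Dual K L) : LinearMap.ker (coadjointMap K f) = coadjointStabilizer K f := by
  ext x
  constructor
  · intro h y
    exact LinearMap.congr_fun (LinearMap.mem_ker.1 h) y
  · intro h
    exact LinearMap.mem_ker.2 (LinearMap.ext fun y => h y)

/-- On a complement `W` of the stabilizer of `f`, the map `x ↦ f([x, ·])` has a left inverse `g`. If
the stabilizer of `f₀ - s f` meets `W`, then `s` is an eigenvalue of the endomorphism `g ∘ f₀([·,
·])` of `W`, which leaves finitely many `s`. -/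
theorem finite_finrank_coadjointStabilizer_lt {K L : Type*} [Field K] [LieRing L] [LieAlgebra K L]
    [FiniteDimensional K L] (f₀ f : Module.Dual K L) :
    {s : K | Module.finrank K (coadjointStabilizer K f) <
      Module.finrank K (coadjointStabilizer K (f₀ - s • f))}.Finite := by
  obtain ⟨W, hW⟩ := Submodule.exists_isCompl (coadjointStabilizer K f)
  set φ : W →ₗ[K] Module.Dual K L := coadjointMap K f ∘ₗ W.subtype with hφ
  have hker : LinearMap.ker φ = ⊥ := by
    rw [LinearMap.ker_eq_bot']
    intro x hx
    have h1 : (x : L) ∈ coadjointStabilizer K f := by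
      rw [← ker_coadjointMap]
      exact LinearMap.mem_ker.2 hx
    exact Subtype.ext (Submodule.disjoint_def.1 hW.disjoint _ h1 x.2)
  obtain ⟨g, hg⟩ := LinearMap.exists_leftInverse_of_injective φ hker
  let E : Module.End K W := g ∘ₗ coadjointMap K f₀ ∘ₗ W.subtype
  refine (Module.End.finite_hasEigenvalue E).subset ?_
  intro s hs
  by_contra hE
  refine absurd (Set.mem_ofPred_eq ▸ hs : _ < _) (not_lt.2 ?_)
  have hdisj : Disjoint (coadjointStabilizer K (f₀ - s • f)) W := by
    rw [Submodule.disjoint_def]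
    intro x hx hxW
    rw [← ker_coadjointMap, LinearMap.mem_ker, map_sub, map_smul, LinearMap.sub_apply,
      LinearMap.smul_apply, sub_eq_zero] at hx
    have h2 : E ⟨x, hxW⟩ = s • ⟨x, hxW⟩ := by
      change g (coadjointMap K f₀ x) = _
      rw [hx, map_smul]
      congr 1
      exact LinearMap.congr_fun hg ⟨x, hxW⟩
    by_contra hx0
    refine hE (Module.End.hasEigenvalue_of_hasEigenvector (x := ⟨x, hxW⟩)
      ⟨Module.End.mem_eigenspace_iff.2 h2, ?_⟩)
    intro h
    exact hx0 (congrArg Subtype.val h)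
  have h3 := Submodule.finrank_add_finrank_le_of_disjoint hdisj
  have h4 := Submodule.finrank_add_eq_of_isCompl hW
  omega

/-! ### Deformation of an element of a normed algebra -/

/-- The map `(x, τ, ν) ↦ (1 + x)(A + τ)(1 + x)⁻¹ + ν` has derivative `xA - Ax + τ + ν` at the
origin. The hypothesis makes it surjective, so neighbourhoods of the origin map onto neighbourhoods
of `A`. -/
theorem eventually_conjugate_add {R : Type*} [NormedRing R] [NormedAlgebra ℂ R]
    [FiniteDimensional ℂ R] (P T N : Submodule ℂ R) (A : R)
    (h : ∀ Y : R, ∃ x ∈ P, ∃ τ ∈ T, ∃ ν ∈ N, Y = x * A - A * x + τ + ν) :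
    ∃ s : Set R, s ∈ 𝓝 A ∧ ∀ B ∈ s, ∃ u : Rˣ, (u : R) - 1 ∈ P ∧ ∃ τ ∈ T, ∃ ν ∈ N,
      B = u * (A + τ) * (u⁻¹ : Rˣ) + ν := by
  have : CompleteSpace R := FiniteDimensional.complete ℂ R
  have : CompleteSpace P := FiniteDimensional.complete ℂ P
  have : CompleteSpace T := FiniteDimensional.complete ℂ T
  have : CompleteSpace N := FiniteDimensional.complete ℂ N
  let px : (P × T × N) →L[ℂ] R := P.subtypeL ∘L ContinuousLinearMap.fst ℂ P (T × N)
  let pt : (P × T × N) →L[ℂ] R := T.subtypeL ∘L ContinuousLinearMap.fst ℂ T N ∘L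
    ContinuousLinearMap.snd ℂ P (T × N)
  let pn : (P × T × N) →L[ℂ] R := N.subtypeL ∘L ContinuousLinearMap.snd ℂ T N ∘L
    ContinuousLinearMap.snd ℂ P (T × N)
  have hu : HasStrictFDerivAt (fun z : P × T × N => 1 + px z) px 0 := px.hasStrictFDerivAt.const_add 1
  have ht : HasStrictFDerivAt (fun z : P × T × N => A + pt z) pt 0 := pt.hasStrictFDerivAt.const_add A
  have hinv := hasStrictFDerivAt_ringInverse (𝕜 := ℂ) (1 : Rˣ)
  have hu0 : ((1 : Rˣ) : R) = (fun z : P × T × N => 1 + px z) 0 := by simp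
  rw [hu0] at hinv
  have hi := HasStrictFDerivAt.comp (0 : P × T × N) hinv hu
  have hF := (((hu.mul' ht).mul' hi).add pn.hasStrictFDerivAt)
  have hmap := hF.map_nhds_eq_of_surj (by
    rw [LinearMap.range_eq_top]
    intro Y
    obtain ⟨x, hx, τ, hτ, ν, hν, rfl⟩ := h Y
    refine ⟨(⟨x, hx⟩, ⟨τ, hτ⟩, ⟨ν, hν⟩), ?_⟩
    simp [px, pt, pn]
    abel)
  have hU : {z : P × T × N | IsUnit (1 + px z)} ∈ 𝓝 (0 : P × T × N) := by
    refine (Units.isOpen.preimage (by fun_prop : Continuous fun z : P × T × N => 1 + px z)).mem_nhds ?_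
    simp
  have h1 := hmap ▸ image_mem_map hU
  refine ⟨_, by simpa using h1, ?_⟩
  rintro B ⟨z, ⟨u, hz⟩, rfl⟩
  refine ⟨u, ?_, pt z, z.2.1.2, pn z, z.2.2.2, ?_⟩
  · rw [hz, add_sub_cancel_left]
    exact z.1.2
  · simp [← hz]

/-! ### Deformation of a matrix under a block triangular group -/

section Deformation

attribute [local instance] Matrix.linftyOpNormedRing Matrix.linftyOpNormedAlgebra

variable {ι α K : Type*} [Fintype ι] [DecidableEq ι] [LinearOrder α]

/-- The block upper triangular matrices. -/
def blockUpper (β : ι → α) : Submodule ℂ (Matrix ι ι ℂ) where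
  carrier := {M | M.BlockTriangular β}
  zero_mem' := Matrix.blockTriangular_zero
  add_mem' := fun hM hN => hM.add hN
  smul_mem' := by
    intro t M hM i j hij
    simp [hM hij]

/-- The strictly block upper triangular matrices. -/
def strictBlockUpper (β : ι → α) : Submodule ℂ (Matrix ι ι ℂ) where
  carrier := {M | ∀ i j, β j ≤ β i → M i j = 0}
  zero_mem' := by intro i j _; rfl
  add_mem' := by
    intro M N hM hN i j hij
    simp [hM i j hij, hN i j hij]
  smul_mem' := by
    intro t M hM i j hij
    simp [hM i j hij]

/-- The matrices commuting with all diagonal matrices constant on the classes of a colouring. -/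
def colourCommutant (c : ι → K) : Submodule ℂ (Matrix ι ι ℂ) where
  carrier := {M | ∀ w : K → ℂ, M * diagonal (w ∘ c) = diagonal (w ∘ c) * M}
  zero_mem' := by intro w; simp
  add_mem' := by
    intro M N hM hN w
    rw [add_mul, mul_add, hM w, hN w]
  smul_mem' := by
    intro t M hM w
    rw [smul_mul_assoc, mul_smul_comm, hM w]

theorem exists_trace_form (f : Module.Dual ℂ (Matrix ι ι ℂ)) :
    ∃ B : Matrix ι ι ℂ, ∀ X, f X = (B * X).trace := by
  refine ⟨of fun i j => f (single j i 1), fun X => ?_⟩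
  conv_lhs => rw [matrix_eq_sum_single X]
  simp only [map_sum, trace, diag_apply, mul_apply, of_apply]
  rw [Finset.sum_comm]
  refine Finset.sum_congr rfl fun i _ => Finset.sum_congr rfl fun j _ => ?_
  rw [← mul_one (X j i), ← smul_eq_mul, ← smul_single, map_smul]
  simp [mul_comm]

/-- By duality for the trace pairing: a matrix `B` orthogonal to all three subspaces is block upper
triangular (from `ν`), hence stabilizes the form of `A` (from `x`), hence is diagonal and constant
on colours. Such a matrix is orthogonal to the colour commutant only if it vanishes. -/
theorem deformation_surjective (β : ι → α) (c : ι → K) (A : Matrix ι ι ℂ)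
    (hA : ∀ x : Matrix ι ι ℂ, x.BlockTriangular β →
      (∀ i j, β i ≤ β j → (x * A - A * x) j i = 0) → ∃ w : K → ℂ, x = diagonal (w ∘ c))
    (Y : Matrix ι ι ℂ) : ∃ x ∈ blockUpper β, ∃ τ ∈ colourCommutant c, ∃ ν ∈ strictBlockUpper β,
      Y = x * A - A * x + τ + ν := by
  let D : Matrix ι ι ℂ →ₗ[ℂ] Matrix ι ι ℂ := LinearMap.mulRight ℂ A - LinearMap.mulLeft ℂ A
  have hD : ∀ x, D x = x * A - A * x := fun x => rfl
  by_cases htop : ((blockUpper β).map D ⊔ colourCommutant c) ⊔ strictBlockUpper β = ⊤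
  · have hY : Y ∈ ((blockUpper β).map D ⊔ colourCommutant c) ⊔ strictBlockUpper β := by
      rw [htop]; trivial
    obtain ⟨z, hz, ν, hν, rfl⟩ := Submodule.mem_sup.1 hY
    obtain ⟨z', hz', τ, hτ, rfl⟩ := Submodule.mem_sup.1 hz
    obtain ⟨x, hx, rfl⟩ := hz'
    exact ⟨x, hx, τ, hτ, ν, hν, rfl⟩
  · exfalso
    obtain ⟨f, hf0, hf⟩ := Submodule.exists_le_ker_of_lt_top _ (lt_top_iff_ne_top.2 htop)
    obtain ⟨B, hB⟩ := exists_trace_form f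
    have h1 : ∀ x : Matrix ι ι ℂ, x.BlockTriangular β → (B * (x * A - A * x)).trace = 0 := by
      intro x hx
      rw [← hB, ← hD]
      exact hf (Submodule.mem_sup_left (Submodule.mem_sup_left ⟨x, hx, rfl⟩))
    have h2 : ∀ τ ∈ colourCommutant c, (B * τ).trace = 0 := fun τ hτ => by
      rw [← hB]
      exact hf (Submodule.mem_sup_left (Submodule.mem_sup_right hτ))
    have h3 : ∀ ν ∈ strictBlockUpper β, (B * ν).trace = 0 := fun ν hν => by
      rw [← hB]
      exact hf (Submodule.mem_sup_right hν)
    have hBP : B.BlockTriangular β := by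
      intro i j hij
      have h := h3 (single j i 1) (by
        intro k l hkl
        by_contra hne
        rw [single_apply] at hne
        have : j = k ∧ i = l := by
          by_contra h'
          exact hne (if_neg h')
        rw [← this.1, ← this.2] at hkl
        exact absurd hij (not_lt.2 hkl))
      rw [trace_mul_comm, trace_single_mul] at h
      simpa using h
    obtain ⟨w, hw⟩ := hA B hBP (by
      intro i j hij
      have h := h1 (single i j 1) (by
        intro k l hkl
        by_contra hne
        rw [single_apply] at hne
        have : i = k ∧ j = l := by
          by_contra h'
          exact hne (if_neg h')
        rw [← this.1, ← this.2] at hkl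
        exact absurd hkl (not_lt.2 hij))
      have h' : (single i j 1 * (B * A - A * B)).trace = 0 := by
        rw [mul_sub, trace_sub, sub_eq_zero] at h ⊢
        rw [← mul_assoc, ← mul_assoc] at h ⊢
        rw [trace_mul_cycle (single i j 1) A B, h, trace_mul_cycle B]
      rw [trace_single_mul] at h'
      simpa using h')
    -- Pairing `B` with its complex conjugate gives a sum of squared absolute values.
    have h4 := h2 (diagonal ((fun k => star (w k)) ∘ c)) (by
      intro v
      rw [diagonal_mul_diagonal, diagonal_mul_diagonal]
      congr 1
      ext i
      exact mul_comm _ _)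
    rw [hw, diagonal_mul_diagonal, trace_diagonal] at h4
    have h5 : ∀ i, w (c i) = 0 := by
      have h6 : ∑ i, ((Complex.normSq (w (c i)) : ℝ) : ℂ) = 0 := by
        rw [← h4]
        refine Finset.sum_congr rfl fun i _ => ?_
        exact (Complex.mul_conj _).symm
      rw [← Complex.ofReal_sum, Complex.ofReal_eq_zero,
        Finset.sum_eq_zero_iff_of_nonneg fun i _ => Complex.normSq_nonneg _] at h6
      exact fun i => Complex.normSq_eq_zero.1 (h6 i (Finset.mem_univ i))
    have hB0 : B = 0 := by
      rw [hw]
      ext i j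
      by_cases hij : i = j
      · subst hij; simp [h5]
      · simp [hij]
    exact hf0 (LinearMap.ext fun X => by simp [hB X, hB0])

theorem eventually_conjugate (β : ι → α) (c : ι → K) (A : Matrix ι ι ℂ)
    (hA : ∀ x : Matrix ι ι ℂ, x.BlockTriangular β →
      (∀ i j, β i ≤ β j → (x * A - A * x) j i = 0) → ∃ w : K → ℂ, x = diagonal (w ∘ c))
    (B : Matrix ι ι ℂ) :
    ∀ᶠ s in 𝓝 (0 : ℂ), ∃ u : (Matrix ι ι ℂ)ˣ,
      (u : Matrix ι ι ℂ).BlockTriangular β ∧ ∃ τ ∈ colourCommutant c, ∃ ν ∈ strictBlockUpper β,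
        A - s • B = u * (A + τ) * (u⁻¹ : (Matrix ι ι ℂ)ˣ) + ν := by
  obtain ⟨S, hS, h⟩ := eventually_conjugate_add (blockUpper β) (colourCommutant c)
    (strictBlockUpper β) A (deformation_surjective β c A hA)
  have hcont : Tendsto (fun s : ℂ => A - s • B) (𝓝 0) (𝓝 A) := by
    have : Continuous fun s : ℂ => A - s • B := by fun_prop
    simpa using this.tendsto 0
  filter_upwards [hcont hS] with s hs
  obtain ⟨u, hu, h'⟩ := h _ hs
  refine ⟨u, ?_, h'⟩
  have := Matrix.BlockTriangular.add (show ((u : Matrix ι ι ℂ) - 1).BlockTriangular β from hu)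
    Matrix.blockTriangular_one
  simpa using this

end Deformation

/-! ### The index of a parabolic subalgebra with a toral stabilizer -/

theorem trace_strictBlockUpper_mul {ι α : Type*} [Fintype ι] [LinearOrder α]
    {β : ι → α} {ν z : Matrix ι ι ℂ} (hν : ν ∈ strictBlockUpper β) (hz : z.BlockTriangular β) :
    (ν * z).trace = 0 := by
  simp only [trace, diag_apply, mul_apply]
  refine Finset.sum_eq_zero fun i _ => Finset.sum_eq_zero fun j _ => ?_
  rcases le_or_gt (β j) (β i) with h | h
  · rw [hν i j h, zero_mul]
  · rw [hz h, mul_zero]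

section Index

variable {n : ℕ} (κ : Composition n)

/-- The linear form `x ↦ tr(A x)` on a parabolic subalgebra. -/
def traceForm (A : Matrix (Fin n) (Fin n) ℂ) : Module.Dual ℂ (parabolicSubalgebra κ) :=
  (Matrix.traceLinearMap (Fin n) ℂ ℂ ∘ₗ LinearMap.mulLeft ℂ A) ∘ₗ
    (parabolicSubalgebra κ).toSubmodule.subtype

theorem traceForm_apply (A : Matrix (Fin n) (Fin n) ℂ) (x : parabolicSubalgebra κ) :
    traceForm κ A x = (A * (x : Matrix (Fin n) (Fin n) ℂ)).trace := rfl

theorem traceForm_lie (A : Matrix (Fin n) (Fin n) ℂ) (x y : parabolicSubalgebra κ) :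
    traceForm κ A ⁅x, y⁆ =
      -(((x : Matrix (Fin n) (Fin n) ℂ) * A - A * x) * (y : Matrix (Fin n) (Fin n) ℂ)).trace := by
  rw [traceForm_apply, LieSubalgebra.coe_bracket, Ring.lie_def, mul_sub, sub_mul, trace_sub,
    trace_sub, ← mul_assoc, ← mul_assoc, trace_mul_cycle A (y : Matrix (Fin n) (Fin n) ℂ)]
  ring

theorem exists_traceForm (f : Module.Dual ℂ (parabolicSubalgebra κ)) :
    ∃ A, f = traceForm κ A := by
  obtain ⟨g, hg⟩ := LinearMap.exists_extend (p := (parabolicSubalgebra κ).toSubmodule) f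
  obtain ⟨A, hA⟩ := exists_trace_form g
  refine ⟨A, LinearMap.ext fun x => ?_⟩
  rw [traceForm_apply, ← hA]
  exact (LinearMap.congr_fun hg x).symm

/-- If the stabilizer of a form on a parabolic subalgebra consists of the diagonal matrices that are
constant on the classes of a colouring, then its dimension is the index. -/
theorem lieIndex_eq_card {K : Type*} [Fintype K] (c : Fin n → K) (hc : Function.Surjective c)
    (A : Matrix (Fin n) (Fin n) ℂ) (hA : A ∈ colourCommutant c)
    (hS : ∀ x : Matrix (Fin n) (Fin n) ℂ, x.BlockTriangular κ.index →
      (∀ i j, κ.index i ≤ κ.index j → (x * A - A * x) j i = 0) →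
        ∃ w : K → ℂ, x = diagonal (w ∘ c)) :
    lieIndex ℂ (parabolicSubalgebra κ) = Fintype.card K := by
  classical
  let δ : (K → ℂ) →ₗ[ℂ] Matrix (Fin n) (Fin n) ℂ :=
    Matrix.diagonalLinearMap (Fin n) ℂ ℂ ∘ₗ LinearMap.funLeft ℂ ℂ c
  have hδ : ∀ w, δ w = diagonal (w ∘ c) := fun w => rfl
  have hδinj : Function.Injective δ := by
    intro w w' h
    rw [hδ, hδ] at h
    exact hc.injective_comp_right (diagonal_injective h)
  have hcomm : ∀ τ ∈ colourCommutant c, ∀ w, δ w * (A + τ) = (A + τ) * δ w := by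
    intro τ hτ w
    exact (Submodule.add_mem _ hA hτ w).symm
  -- the stabilizer of a form near the given one
  have hlow : ∀ (u : (Matrix (Fin n) (Fin n) ℂ)ˣ), (u : Matrix (Fin n) (Fin n) ℂ).BlockTriangular
      κ.index → ∀ τ ∈ colourCommutant c, ∀ ν ∈ strictBlockUpper κ.index,
      Fintype.card K ≤ Module.finrank ℂ (coadjointStabilizer ℂ (traceForm κ
        (u * (A + τ) * (u⁻¹ : (Matrix (Fin n) (Fin n) ℂ)ˣ) + ν))) := by
    intro u hu τ hτ ν hν
    have hu' : ((u⁻¹ : (Matrix (Fin n) (Fin n) ℂ)ˣ) :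
        Matrix (Fin n) (Fin n) ℂ).BlockTriangular κ.index := by
      have : Invertible (u : Matrix (Fin n) (Fin n) ℂ) := u.invertible
      rw [Matrix.coe_units_inv]
      exact Matrix.blockTriangular_inv_of_blockTriangular hu
    have hbt : ∀ w, ((u : Matrix (Fin n) (Fin n) ℂ) * δ w *
        (u⁻¹ : (Matrix (Fin n) (Fin n) ℂ)ˣ)).BlockTriangular κ.index := by
      intro w
      exact (hu.mul (blockTriangular_diagonal _)).mul hu'
    let γ : (K → ℂ) →ₗ[ℂ] parabolicSubalgebra κ :=
      LinearMap.codRestrict (parabolicSubalgebra κ).toSubmodule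
        (LinearMap.mulRight ℂ ((u⁻¹ : (Matrix (Fin n) (Fin n) ℂ)ˣ) : Matrix (Fin n) (Fin n) ℂ) ∘ₗ
          LinearMap.mulLeft ℂ (u : Matrix (Fin n) (Fin n) ℂ) ∘ₗ δ) hbt
    have hγ : ∀ w, ((γ w : parabolicSubalgebra κ) : Matrix (Fin n) (Fin n) ℂ) =
      u * δ w * (u⁻¹ : (Matrix (Fin n) (Fin n) ℂ)ˣ) := fun w => rfl
    have hγinj : Function.Injective γ := by
      intro w w' h
      have h1 := congrArg (Subtype.val) h
      rw [hγ, hγ] at h1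
      exact hδinj (u.isUnit.mul_left_cancel ((u⁻¹).isUnit.mul_right_cancel h1))
    have hγmem : LinearMap.range γ ≤ coadjointStabilizer ℂ (traceForm κ
        (u * (A + τ) * (u⁻¹ : (Matrix (Fin n) (Fin n) ℂ)ˣ) + ν)) := by
      rintro _ ⟨w, rfl⟩ y
      have h1 : traceForm κ (u * (A + τ) * (u⁻¹ : (Matrix (Fin n) (Fin n) ℂ)ˣ) + ν) =
          traceForm κ (u * (A + τ) * (u⁻¹ : (Matrix (Fin n) (Fin n) ℂ)ˣ)) := by
        refine LinearMap.ext fun z => ?_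
        rw [traceForm_apply, traceForm_apply, add_mul, trace_add,
          trace_strictBlockUpper_mul hν z.2, add_zero]
      rw [h1, traceForm_lie, hγ]
      have h2 : (u : Matrix (Fin n) (Fin n) ℂ) * δ w * (u⁻¹ : (Matrix (Fin n) (Fin n) ℂ)ˣ) *
          (u * (A + τ) * (u⁻¹ : (Matrix (Fin n) (Fin n) ℂ)ˣ)) -
          u * (A + τ) * (u⁻¹ : (Matrix (Fin n) (Fin n) ℂ)ˣ) *
          (u * δ w * (u⁻¹ : (Matrix (Fin n) (Fin n) ℂ)ˣ)) = 0 := by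
        have e : ∀ a b : Matrix (Fin n) (Fin n) ℂ,
            (u : Matrix (Fin n) (Fin n) ℂ) * a * (u⁻¹ : (Matrix (Fin n) (Fin n) ℂ)ˣ) *
            (u * b * (u⁻¹ : (Matrix (Fin n) (Fin n) ℂ)ˣ)) =
            u * (a * b) * (u⁻¹ : (Matrix (Fin n) (Fin n) ℂ)ˣ) := by
          intro a b
          simp only [mul_assoc, Units.inv_mul_cancel_left]
        rw [e, e, hcomm τ hτ w, sub_self]
      rw [h2, zero_mul, trace_zero, neg_zero]
    calc Fintype.card K = Module.finrank ℂ (K → ℂ) := (Module.finrank_fintype_fun_eq_card ℂ).symm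
      _ = Module.finrank ℂ (LinearMap.range γ) := (LinearMap.finrank_range_of_inj hγinj).symm
      _ ≤ _ := Submodule.finrank_mono hγmem
  -- the stabilizer of the given form
  have hup : Module.finrank ℂ (coadjointStabilizer ℂ (traceForm κ A)) ≤ Fintype.card K := by
    have h1 : (coadjointStabilizer ℂ (traceForm κ A)).map
        (parabolicSubalgebra κ).toSubmodule.subtype ≤ LinearMap.range δ := by
      rintro _ ⟨x, hx, rfl⟩
      obtain ⟨w, hw⟩ := hS x x.2 (by
        intro i j hij
        have hs : (single i j (1 : ℂ)).BlockTriangular κ.index := by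
          intro k l hkl
          by_contra hne
          rw [single_apply] at hne
          have : i = k ∧ j = l := by
            by_contra h'
            exact hne (if_neg h')
          rw [← this.1, ← this.2] at hkl
          exact absurd hkl (not_lt.2 hij)
        have h := hx ⟨single i j 1, hs⟩
        rw [traceForm_lie, neg_eq_zero, trace_mul_comm, trace_single_mul, one_smul] at h
        exact h)
      exact ⟨w, hw.symm⟩
    calc Module.finrank ℂ (coadjointStabilizer ℂ (traceForm κ A)) = Module.finrank ℂ
          ((coadjointStabilizer ℂ (traceForm κ A)).map
            (parabolicSubalgebra κ).toSubmodule.subtype) :=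
          (LinearEquiv.finrank_eq (Submodule.equivMapOfInjective _
            (Submodule.injective_subtype _) _))
      _ ≤ Module.finrank ℂ (LinearMap.range δ) := Submodule.finrank_mono h1
      _ = Fintype.card K := by
          rw [LinearMap.finrank_range_of_inj hδinj, Module.finrank_fintype_fun_eq_card]
  have hall : ∀ f : Module.Dual ℂ (parabolicSubalgebra κ),
      Fintype.card K ≤ Module.finrank ℂ (coadjointStabilizer ℂ f) := by
    intro f
    obtain ⟨B, rfl⟩ := exists_traceForm κ f
    have hfin := finite_finrank_coadjointStabilizer_lt (traceForm κ A) (traceForm κ B)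
    have hev := eventually_conjugate κ.index c A hS B
    have hcof : ∀ᶠ s in 𝓝[≠] (0 : ℂ), ¬ (Module.finrank ℂ (coadjointStabilizer ℂ (traceForm κ B)) <
        Module.finrank ℂ (coadjointStabilizer ℂ (traceForm κ A - s • traceForm κ B))) :=
      nhdsNE_le_cofinite 0 hfin.compl_mem_cofinite
    -- A small nonzero `s` outside the finite exceptional set: the perturbed form is both close to
    -- `A` and no more degenerate than the form of `B`.
    obtain ⟨s, hs1, u, hu, τ, hτ, ν, hν, hs2⟩ :=
      (hcof.and (hev.filter_mono nhdsWithin_le_nhds)).exists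
    have h1 : traceForm κ A - s • traceForm κ B = traceForm κ (A - s • B) := by
      refine LinearMap.ext fun z => ?_
      simp [traceForm_apply, sub_mul]
    rw [h1, hs2] at hs1
    exact (hlow u hu τ hτ ν hν).trans (not_lt.1 hs1)
  unfold lieIndex
  refine le_antisymm (le_trans (Nat.sInf_le (Set.mem_range_self (traceForm κ A))) hup) ?_
  refine le_csInf (Set.range_nonempty _) ?_
  rintro _ ⟨f, rfl⟩
  exact hall f

end Index

/-! ### Star-shaped data -/

theorem eq_diagonal_of_commute {ι : Type*} [Fintype ι] [DecidableEq ι] {a : ι → ℂ}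
    (ha : Function.Injective a) {t : Matrix ι ι ℂ} (h : t * diagonal a = diagonal a * t) :
    t = diagonal fun i => t i i := by
  ext i j
  by_cases hij : i = j
  · subst hij; simp
  · have h1 := congrFun (congrFun h i) j
    rw [mul_diagonal, diagonal_mul, mul_comm, ← sub_eq_zero, ← sub_mul] at h1
    rw [diagonal_apply_ne _ hij]
    exact (mul_eq_zero.1 h1).resolve_left (sub_ne_zero.2 fun h' => hij (ha h').symm)

/-- Data `M → C ← R` with endomorphisms of `C` and `R`, compatible with a colouring by `M ⊕ Fin N`,
whose symmetries are as few as the colouring allows. -/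
structure IsStar (M C R : Type) [Fintype M] [DecidableEq M] [Fintype C] [DecidableEq C] [Fintype R]
    [DecidableEq R] (N : ℕ) (k : Matrix C M ℂ) (e : Matrix C R ℂ) (a : Matrix R R ℂ)
    (f : Matrix C C ℂ) (γ : C → M ⊕ Fin N) (ρ : R → M ⊕ Fin N) : Prop where
  surj : ∀ l, (∃ i, γ i = .inr l) ∨ ∃ i, ρ i = .inr l
  comm_k : ∀ u v, (diagonal (Sum.elim u v ∘ γ) : Matrix C C ℂ) * k = k * (diagonal u : Matrix M M ℂ)
  comm_e : ∀ u v, (diagonal (Sum.elim u v ∘ γ) : Matrix C C ℂ) * e =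
    e * (diagonal (Sum.elim u v ∘ ρ) : Matrix R R ℂ)
  comm_a : ∀ u v, diagonal (Sum.elim u v ∘ ρ) * a = a * diagonal (Sum.elim u v ∘ ρ)
  comm_f : ∀ u v, diagonal (Sum.elim u v ∘ γ) * f = f * diagonal (Sum.elim u v ∘ γ)
  sol : ∀ (x : Matrix M M ℂ) (y : Matrix C C ℂ) (t : Matrix R R ℂ) (p : Matrix M C ℂ)
    (s : Matrix R C ℂ), y * k = k * x → y * e = e * t → t * a - a * t + s * e = 0 →
    y * f - f * y = k * p + e * s → p * k = 0 ∧ ∀ u, x = diagonal u → p = 0 ∧ s = 0 ∧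
      ∃ v, y = diagonal (Sum.elim u v ∘ γ) ∧ t = diagonal (Sum.elim u v ∘ ρ)

/-- The part outside the first diagonal block of a matrix of type `(M, R, D)`, compatible with a
colouring by `M ⊕ Fin N`, whose symmetries are as few as the colouring allows. -/
structure IsPair (M R D : Type) [Fintype M] [DecidableEq M] [Fintype R] [DecidableEq R] [Fintype D]
    [DecidableEq D] (N : ℕ) (k : Matrix (R ⊕ D) M ℂ) (f : Matrix (R ⊕ D) (R ⊕ D) ℂ)
    (δ : R ⊕ D → M ⊕ Fin N) : Prop where
  surj : ∀ l, ∃ i, δ i = .inr l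
  comm_k : ∀ u v, (diagonal (Sum.elim u v ∘ δ) : Matrix (R ⊕ D) (R ⊕ D) ℂ) * k =
    k * (diagonal u : Matrix M M ℂ)
  comm_f : ∀ u v, diagonal (Sum.elim u v ∘ δ) * f = f * diagonal (Sum.elim u v ∘ δ)
  -- With `f` and `k` as the lower right and lower left blocks of a matrix, `p * k` is the
  -- contribution of the outer blocks to the equation at `M`. Its vanishing lets a toral form be
  -- placed there independently.
  sol : ∀ (x : Matrix M M ℂ) (t : Matrix R R ℂ) (w : Matrix R D ℂ) (z : Matrix D D ℂ)
    (p : Matrix M (R ⊕ D) ℂ) (s : Matrix R D ℂ), fromBlocks t w 0 z * k = k * x →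
    fromBlocks t w 0 z * f - f * fromBlocks t w 0 z = k * p + fromBlocks 0 s 0 0 →
    p * k = 0 ∧ ∀ u, x = diagonal u → p = 0 ∧
      ∃ v, fromBlocks t w 0 z = diagonal (Sum.elim u v ∘ δ)

/-! ### Euclidean steps on stars and pairs -/

section Steps

variable {M C R D : Type} [Fintype M] [DecidableEq M] [Fintype C] [DecidableEq C] [Fintype R]
    [DecidableEq R] [Fintype D] [DecidableEq D] {N : ℕ}

/-- With `C` empty only the centralizer of a diagonal matrix with distinct entries remains; this is
where the `N` free colours originate. -/
theorem isStar_base (M : Type) [Fintype M] [DecidableEq M] (N : ℕ) :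
    IsStar M (Fin 0) (Fin N) N 0 0 (diagonal fun i => ((i : ℕ) : ℂ)) 0 finZeroElim Sum.inr where
  surj l := Or.inr ⟨l, rfl⟩
  comm_k u v := by simp
  comm_e u v := by simp
  comm_a u v := by simp [diagonal_mul_diagonal, mul_comm]
  comm_f u v := by simp
  sol x y t p s _ _ ht _ := by
    refine ⟨by simp, fun u _ => ⟨Subsingleton.elim _ _, Subsingleton.elim _ _, fun i => t i i,
      Subsingleton.elim _ _, ?_⟩⟩
    rw [Matrix.mul_zero, add_zero, sub_eq_zero] at ht
    exact eq_diagonal_of_commute (Nat.cast_injective.comp Fin.val_injective) ht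

theorem diagonal_sum_elim {R D : Type*} [DecidableEq R] [DecidableEq D] (a : R → ℂ)
    (b : D → ℂ) : diagonal (Sum.elim a b) = fromBlocks (diagonal a) 0 0 (diagonal b) := by
  simp

/-- The new arrow is the projection `R ⊕ C → C`, so the endomorphism `t` of `R ⊕ C` must be block
upper triangular and induce `y` on `C`. Its off-diagonal block plays the role of the old `s`. -/
theorem IsStar.sum_right {k : Matrix C M ℂ} {e : Matrix C R ℂ} {a : Matrix R R ℂ}
    {f : Matrix C C ℂ} {γ : C → M ⊕ Fin N} {ρ : R → M ⊕ Fin N} (h : IsStar M C R N k e a f γ ρ) :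
    IsStar M C (R ⊕ C) N k (fromCols 0 1) (fromBlocks a 0 e f) 0 γ (Sum.elim ρ γ) where
  surj l := by
    rcases h.surj l with ⟨i, hi⟩ | ⟨i, hi⟩
    · exact Or.inl ⟨i, hi⟩
    · exact Or.inr ⟨.inl i, hi⟩
  comm_k := h.comm_k
  comm_e u v := by
    rw [Sum.comp_elim, diagonal_sum_elim, mul_fromCols, fromCols_mul_fromBlocks]
    simp
  comm_a u v := by
    rw [Sum.comp_elim, diagonal_sum_elim, fromBlocks_multiply, fromBlocks_multiply]
    simp [h.comm_a u v, h.comm_e u v, h.comm_f u v]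
  comm_f u v := by simp
  sol x y t p s hk he ha hf := by
    obtain ⟨α, β, t₁, t₂, rfl⟩ : ∃ α β t₁ t₂, t = fromBlocks α β t₁ t₂ :=
      ⟨_, _, _, _, (fromBlocks_toBlocks t).symm⟩
    obtain ⟨s₁, s₂, rfl⟩ : ∃ s₁ s₂, s = fromRows s₁ s₂ := ⟨_, _, (fromRows_toRows s).symm⟩
    rw [mul_fromCols, fromCols_mul_fromBlocks] at he
    simp only [Matrix.mul_zero, Matrix.mul_one, Matrix.zero_mul, Matrix.one_mul, zero_add,
      fromCols_inj.eq_iff] at he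
    obtain ⟨rfl, rfl⟩ := he
    simp only [fromBlocks_multiply, Matrix.mul_zero, Matrix.zero_mul, add_zero, zero_add,
      mul_fromCols, Matrix.mul_one, fromCols_mul_fromRows, Matrix.one_mul,
      sub_self] at ha hf
    have h11 : α * a - a * α + β * e = 0 := by
      ext i j
      have := congrFun (congrFun ha (.inl i)) (.inl j)
      simp at this
      simp [← this]
      ring
    have h12 : β * f - a * β + s₁ = 0 := by
      ext i j
      simpa using congrFun (congrFun ha (.inl i)) (.inr j)
    have h21 : y * e = e * α := by
      ext i j
      simpa [sub_eq_zero] using congrFun (congrFun ha (.inr i)) (.inl j)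
    have h22 : y * f - (e * β + f * y) + s₂ = 0 := by
      ext i j
      simpa using congrFun (congrFun ha (.inr i)) (.inr j)
    obtain ⟨hT, hd⟩ := h.sol x y α p β hk h21 h11 (by
      rw [eq_neg_of_add_eq_zero_left hf.symm, ← sub_eq_zero, ← h22]
      abel)
    refine ⟨hT, fun u hu => ?_⟩
    obtain ⟨rfl, rfl, v, rfl, rfl⟩ := hd u hu
    have hs₁ : s₁ = 0 := by simpa using h12
    have hs₂ : s₂ = 0 := by simpa using hf.symm
    refine ⟨rfl, by rw [hs₁, hs₂, fromRows_zero], v, rfl, ?_⟩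
    rw [Sum.comp_elim, diagonal_sum_elim]

/-- The arrow `R → R ⊕ D` is the inclusion, and commuting with it cuts the endomorphisms of `R ⊕ D`
down to those of block upper triangular form. -/
theorem IsPair.toStar {k : Matrix (R ⊕ D) M ℂ} {f : Matrix (R ⊕ D) (R ⊕ D) ℂ}
    {δ : R ⊕ D → M ⊕ Fin N} (h : IsPair M R D N k f δ) :
    IsStar M (R ⊕ D) R N k (fromRows 1 0) 0 f δ (δ ∘ Sum.inl) where
  surj l := Or.inl (h.surj l)
  comm_k := h.comm_k
  comm_e u v := by
    obtain ⟨δ₁, δ₂, rfl⟩ : ∃ δ₁ δ₂, δ = Sum.elim δ₁ δ₂ := ⟨_, _, (Sum.elim_comp_inl_inr δ).symm⟩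
    rw [Sum.comp_elim, diagonal_sum_elim, fromBlocks_mul_fromRows, fromRows_mul]
    simp
  comm_a u v := by simp
  comm_f := h.comm_f
  sol x y t p s hk he ha hf := by
    obtain ⟨t', w, z', z, rfl⟩ : ∃ α β t₁ t₂, y = fromBlocks α β t₁ t₂ :=
      ⟨_, _, _, _, (fromBlocks_toBlocks y).symm⟩
    obtain ⟨s₁, s₂, rfl⟩ : ∃ s₁ s₂, s = fromCols s₁ s₂ := ⟨_, _, (fromCols_toCols s).symm⟩
    simp only [fromBlocks_mul_fromRows, fromRows_mul, Matrix.mul_zero, Matrix.mul_one,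
      Matrix.zero_mul, Matrix.one_mul, add_zero, fromRows_inj.eq_iff] at he
    obtain ⟨rfl, rfl⟩ := he
    simp only [fromCols_mul_fromRows, Matrix.mul_zero, Matrix.mul_one,
      Matrix.zero_mul, add_zero, zero_add, sub_self] at ha
    subst ha
    have hes : fromRows (1 : Matrix R R ℂ) (0 : Matrix D R ℂ) * fromCols (0 : Matrix R R ℂ) s₂ =
        fromBlocks 0 s₂ 0 0 := by
      rw [fromRows_mul_fromCols]
      simp
    rw [hes] at hf
    obtain ⟨hT, hd⟩ := h.sol x _ w z p s₂ hk hf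
    refine ⟨hT, fun u hu => ?_⟩
    obtain ⟨rfl, v, hv⟩ := hd u hu
    refine ⟨rfl, ?_, v, hv, ?_⟩
    · rw [hv, h.comm_f, sub_self, Matrix.mul_zero, zero_add] at hf
      have hs : s₂ = 0 := by
        ext i j
        simpa using (congrFun (congrFun hf (.inl i)) (.inr j)).symm
      rw [hs, fromCols_zero]
    · ext i j
      have := congrFun (congrFun hv (.inl i)) (.inl j)
      simpa [diagonal_apply] using this

/-- Embedding `M` into `D = M ⊕ C` forces `z` to preserve `M` and to act there as `x`. The remaining
equations are those of the star, with the off-diagonal blocks `z₂` and `w₂` as its `p` and `s`. -/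
theorem IsStar.toPair {k : Matrix C M ℂ} {e : Matrix C R ℂ} {a : Matrix R R ℂ}
    {f : Matrix C C ℂ} {γ : C → M ⊕ Fin N} {ρ : R → M ⊕ Fin N} (h : IsStar M C R N k e a f γ ρ) :
    IsPair M R (M ⊕ C) N (fromRows 0 (fromRows 1 0))
      (fromBlocks a 0 (fromRows 0 e) (fromBlocks 0 0 k f)) (Sum.elim ρ (Sum.elim Sum.inl γ)) where
  surj l := by
    rcases h.surj l with ⟨i, hi⟩ | ⟨i, hi⟩
    · exact ⟨.inr (.inr i), hi⟩
    · exact ⟨.inl i, hi⟩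
  comm_k u v := by
    simp only [Sum.comp_elim, diagonal_sum_elim, fromBlocks_mul_fromRows, fromRows_mul]
    simp
  comm_f u v := by
    simp only [Sum.comp_elim, diagonal_sum_elim, fromBlocks_multiply, fromRows_mul,
      fromBlocks_mul_fromRows]
    simp [h.comm_a u v, h.comm_e u v, h.comm_f u v, h.comm_k u v]
  sol x t w z p s hk hf := by
    obtain ⟨z₁, z₂, z₃, z₄, rfl⟩ : ∃ α β t₁ t₂, z = fromBlocks α β t₁ t₂ :=
      ⟨_, _, _, _, (fromBlocks_toBlocks z).symm⟩
    obtain ⟨w₁, w₂, rfl⟩ : ∃ s₁ s₂, w = fromCols s₁ s₂ := ⟨_, _, (fromCols_toCols w).symm⟩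
    obtain ⟨s₁, s₂, rfl⟩ : ∃ s₁ s₂, s = fromCols s₁ s₂ := ⟨_, _, (fromCols_toCols s).symm⟩
    obtain ⟨p₁, p₂, rfl⟩ : ∃ s₁ s₂, p = fromCols s₁ s₂ := ⟨_, _, (fromCols_toCols p).symm⟩
    obtain ⟨p₂, p₃, rfl⟩ : ∃ s₁ s₂, p₂ = fromCols s₁ s₂ := ⟨_, _, (fromCols_toCols p₂).symm⟩
    simp only [fromBlocks_mul_fromRows, fromRows_mul, fromCols_mul_fromRows, Matrix.mul_zero,
      Matrix.mul_one, Matrix.zero_mul, Matrix.one_mul, add_zero, zero_add,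
      fromRows_inj.eq_iff] at hk
    obtain ⟨rfl, rfl, rfl⟩ := hk
    simp only [fromBlocks_multiply, fromBlocks_mul_fromRows, fromRows_mul, fromCols_mul_fromRows,
      fromCols_mul_fromBlocks, mul_fromCols, Matrix.mul_zero, Matrix.zero_mul, Matrix.one_mul,
      add_zero, zero_add] at hf
    have e11 : t * a - a * t + w₂ * e = 0 := by
      ext i j
      have := congrFun (congrFun hf (.inl i)) (.inl j)
      simp at this
      simp [← this]
      ring
    have e12 : w₂ * k = s₁ := by
      ext i j
      simpa using congrFun (congrFun hf (.inl i)) (.inr (.inl j))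
    have e13 : w₂ * f - a * w₂ = s₂ := by
      ext i j
      simpa using congrFun (congrFun hf (.inl i)) (.inr (.inr j))
    have e21 : z₂ * e = p₁ := by
      ext i j
      simpa using congrFun (congrFun hf (.inr (.inl i))) (.inl j)
    have e22 : z₂ * k = p₂ := by
      ext i j
      simpa using congrFun (congrFun hf (.inr (.inl i))) (.inr (.inl j))
    have e23 : z₂ * f = p₃ := by
      ext i j
      simpa using congrFun (congrFun hf (.inr (.inl i))) (.inr (.inr j))
    have e31 : z₄ * e = e * t := by
      ext i j
      simpa [sub_eq_zero] using congrFun (congrFun hf (.inr (.inr i))) (.inl j)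
    have e32 : z₄ * k = k * z₁ := by
      ext i j
      simpa [sub_eq_zero] using congrFun (congrFun hf (.inr (.inr i))) (.inr (.inl j))
    have e33 : z₄ * f - (e * w₂ + (k * z₂ + f * z₄)) = 0 := by
      ext i j
      simpa using congrFun (congrFun hf (.inr (.inr i))) (.inr (.inr j))
    obtain ⟨hT, hd⟩ := h.sol z₁ z₄ t z₂ w₂ e32 e31 e11 (by
      rw [← sub_eq_zero, ← e33]
      abel)
    refine ⟨?_, fun u hu => ?_⟩
    · rw [fromCols_mul_fromRows, fromCols_mul_fromRows]
      simpa [e22] using hT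
    · obtain ⟨rfl, rfl, v, rfl, rfl⟩ := hd u hu
      refine ⟨?_, v, ?_⟩
      · rw [← e21, ← e22, ← e23]
        simp
      · rw [Sum.comp_elim, Sum.comp_elim, diagonal_sum_elim, diagonal_sum_elim, hu]
        simp [Sum.elim_comp_inl]

/-- The Euclidean algorithm on `(m + r, c)`. -/
theorem exists_isStar (M : Type) [Fintype M] [DecidableEq M] (hM : 0 < Fintype.card M) (N : ℕ) :
    ∀ s c r : ℕ, c + r = s → Nat.gcd (Fintype.card M + r) c = Fintype.card M + N →
    ∃ (C R : Type) (_ : Fintype C) (_ : DecidableEq C) (_ : Fintype R) (_ : DecidableEq R),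
      Fintype.card C = c ∧ Fintype.card R = r ∧ ∃ k e a f γ ρ, IsStar M C R N k e a f γ ρ := by
  intro s
  induction s using Nat.strong_induction_on with
  | _ s ih =>
    intro c r hs hg
    rcases Nat.eq_zero_or_pos c with rfl | hc
    · rw [Nat.gcd_zero_right] at hg
      obtain rfl : r = N := by omega
      exact ⟨Fin 0, Fin r, inferInstance, inferInstance, inferInstance, inferInstance, by simp,
        by simp, _, _, _, _, _, _, isStar_base M r⟩
    · by_cases h1 : c ≤ r
      · obtain ⟨q, rfl⟩ := Nat.exists_eq_add_of_le' h1
        rw [← add_assoc, Nat.gcd_add_self_left] at hg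
        obtain ⟨C, R, _, _, _, _, hC, hR, k, e, a, f, γ, ρ, h⟩ :=
          ih (c + q) (by omega) c q rfl hg
        exact ⟨C, R ⊕ C, inferInstance, inferInstance, inferInstance, inferInstance, hC,
          by simp [hC, hR], _, _, _, _, _, _, h.sum_right⟩
      · by_cases h2 : Fintype.card M + r ≤ c
        · obtain ⟨q, rfl⟩ := Nat.exists_eq_add_of_le' h2
          rw [Nat.gcd_add_self_right] at hg
          obtain ⟨C, R, _, _, _, _, hC, hR, k, e, a, f, γ, ρ, h⟩ :=
            ih (q + r) (by omega) q r rfl hg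
          exact ⟨R ⊕ (M ⊕ C), R, inferInstance, inferInstance, inferInstance, inferInstance,
            by simp [hC, hR]; omega, hR, _, _, _, _, _, _, h.toPair.toStar⟩
        -- Here `r < c < |M| + r`, so the difference `|M| + r - c` is positive and less than `|M|`,
        -- although the gcd `|M| + N` divides it.
        · exfalso
          have h3 : Fintype.card M + N ∣ Fintype.card M + r - c :=
            hg ▸ Nat.dvd_sub (Nat.gcd_dvd_left _ _) (Nat.gcd_dvd_right _ _)
          have := Nat.le_of_dvd (by omega) h3
          omega

theorem exists_isPair (M : Type) [Fintype M] [DecidableEq M] (hM : 0 < Fintype.card M) (N b c : ℕ)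
    (hc : 0 < c) (hg : Nat.gcd (Fintype.card M + b) (b + c) = Fintype.card M + N) :
    ∃ (R D : Type) (_ : Fintype R) (_ : DecidableEq R) (_ : Fintype D) (_ : DecidableEq D),
      Fintype.card R = b ∧ Fintype.card D = c ∧ ∃ k f δ, IsPair M R D N k f δ := by
  -- Otherwise the gcd `|M| + N` would divide the positive number `|M| - c`, which is less than
  -- `|M|`.
  have hle : Fintype.card M ≤ c := by
    by_contra hlt
    have h3 : Fintype.card M + N ∣ Fintype.card M + b - (b + c) :=
      hg ▸ Nat.dvd_sub (Nat.gcd_dvd_left _ _) (Nat.gcd_dvd_right _ _)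
    have := Nat.le_of_dvd (by omega) h3
    omega
  obtain ⟨q, rfl⟩ := Nat.exists_eq_add_of_le hle
  rw [← add_assoc, add_comm b, Nat.gcd_self_add_right] at hg
  obtain ⟨C, R, _, _, _, _, hC, hR, k, e, a, f, γ, ρ, h⟩ := exists_isStar M hM N _ q b rfl hg
  exact ⟨R, M ⊕ C, inferInstance, inferInstance, inferInstance, inferInstance, hR,
    by simp [hC], _, _, _, h.toPair⟩

end Steps

/-! ### Three blocks with a distinguished middle block -/

/-- A matrix of type `(A, M, D)`, compatible with a colouring by `M ⊕ Fin N`, whose symmetries, the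
condition at the middle block being waived, are as few as the colouring allows. -/
structure IsMid (A M D : Type) [Fintype A] [DecidableEq A] [Fintype M] [DecidableEq M] [Fintype D]
    [DecidableEq D] (N : ℕ) (F : Matrix (A ⊕ (M ⊕ D)) (A ⊕ (M ⊕ D)) ℂ)
    (α : A → M ⊕ Fin N) (δ : D → M ⊕ Fin N) : Prop where
  surj : ∀ l, (∃ i, α i = .inr l) ∨ ∃ i, δ i = .inr l
  comm : ∀ u v, diagonal (Sum.elim u v ∘ Sum.elim α (Sum.elim Sum.inl δ)) * F =
    F * diagonal (Sum.elim u v ∘ Sum.elim α (Sum.elim Sum.inl δ))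
  sol : ∀ (x : Matrix A A ℂ) (p : Matrix A M ℂ) (q : Matrix A D ℂ) (y : Matrix M M ℂ)
    (w : Matrix M D ℂ) (z : Matrix D D ℂ) (s₁ : Matrix A M ℂ) (s₂ : Matrix A D ℂ)
    (s₃ : Matrix M D ℂ) (T : Matrix M M ℂ),
    fromBlocks x (fromCols p q) 0 (fromBlocks y w 0 z) * F -
      F * fromBlocks x (fromCols p q) 0 (fromBlocks y w 0 z) =
        fromBlocks 0 (fromCols s₁ s₂) 0 (fromBlocks T s₃ 0 0) →
    T = 0 ∧ ∀ u, y = diagonal u → ∃ v, fromBlocks x (fromCols p q) 0 (fromBlocks y w 0 z) =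
      diagonal (Sum.elim u v ∘ Sum.elim α (Sum.elim Sum.inl δ))

/-! ### Euclidean steps around a middle block -/

section MidSteps

variable {A M D : Type} [Fintype A] [DecidableEq A] [Fintype M] [DecidableEq M] [Fintype D]
    [DecidableEq D] {N : ℕ}

/-- The identity between the two outer blocks forces `x = z` and kills `p`, `q` and `w`; the
distinct diagonal entries then make `z` diagonal. -/
theorem isMid_base (M : Type) [Fintype M] [DecidableEq M] (N : ℕ) :
    IsMid (Fin N) M (Fin N) N
      (fromBlocks 0 0 (fromRows 0 1) (fromBlocks 0 0 0 (diagonal fun i => ((i : ℕ) : ℂ))))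
      Sum.inr Sum.inr where
  surj l := Or.inl ⟨l, rfl⟩
  comm u v := by
    simp only [Sum.comp_elim, diagonal_sum_elim, fromBlocks_multiply, fromRows_mul,
      fromBlocks_mul_fromRows]
    simp [mul_comm]
  sol x p q y w z s₁ s₂ s₃ T h := by
    simp only [fromBlocks_multiply, fromBlocks_mul_fromRows, fromRows_mul, fromCols_mul_fromRows,
      fromCols_mul_fromBlocks, mul_fromCols, Matrix.mul_zero, Matrix.mul_one, Matrix.zero_mul,
      Matrix.one_mul, add_zero, zero_add] at h
    have e11 : q = 0 := by
      ext i j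
      simpa using congrFun (congrFun h (.inl i)) (.inl j)
    have e21 : w = 0 := by
      ext i j
      simpa using congrFun (congrFun h (.inr (.inl i))) (.inl j)
    have e22 : T = 0 := by
      ext i j
      simpa using (congrFun (congrFun h (.inr (.inl i))) (.inr (.inl j))).symm
    have e31 : z = x := by
      ext i j
      simpa [sub_eq_zero] using congrFun (congrFun h (.inr (.inr i))) (.inl j)
    have e32 : p = 0 := by
      ext i j
      simpa using congrFun (congrFun h (.inr (.inr i))) (.inr (.inl j))
    have e33 : z * (diagonal fun i : Fin N => ((i : ℕ) : ℂ)) =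
        (diagonal fun i : Fin N => ((i : ℕ) : ℂ)) * z := by
      ext i j
      have := congrFun (congrFun h (.inr (.inr i))) (.inr (.inr j))
      simpa [e11, sub_eq_zero] using this
    refine ⟨e22, fun u hu => ⟨fun i => z i i, ?_⟩⟩
    have hz := eq_diagonal_of_commute (Nat.cast_injective.comp Fin.val_injective) e33
    subst e11 e21 e31 e32 hu
    simp only [Sum.comp_elim, diagonal_sum_elim, fromCols_zero, Sum.elim_comp_inr,
      Sum.elim_comp_inl]
    rw [← hz]

/-- The inclusion of `A ⊕ M` into the new last block reduces its endomorphism to type `(A, M, D)`,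
with diagonal blocks `x` and `y` on `A` and `M`. The equation at that block is the old one; the
entries `q` and `w` above it supply the old free terms, including `T`. -/
theorem IsMid.extend_right {F : Matrix (A ⊕ (M ⊕ D)) (A ⊕ (M ⊕ D)) ℂ} {α : A → M ⊕ Fin N}
    {δ : D → M ⊕ Fin N} (h : IsMid A M D N F α δ) :
    IsMid A M (A ⊕ (M ⊕ D)) N
      (fromBlocks 0 0 (fromRows 0 (fromRows 1 0)) (fromBlocks 0 0 (fromRows 0 (fromRows 1 0)) F))
      α (Sum.elim α (Sum.elim Sum.inl δ)) where
  surj l := by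
    rcases h.surj l with ⟨i, hi⟩ | ⟨i, hi⟩
    · exact Or.inl ⟨i, hi⟩
    · exact Or.inr ⟨.inr (.inr i), hi⟩
  comm u v := by
    have hc := h.comm u v
    simp only [Sum.comp_elim, diagonal_sum_elim] at hc
    simp only [Sum.comp_elim, diagonal_sum_elim, fromBlocks_multiply, fromRows_mul,
      fromBlocks_mul_fromRows, Matrix.mul_zero, Matrix.mul_one, Matrix.zero_mul,
      Matrix.one_mul, add_zero, zero_add, hc]
  sol x p q y w z s₁ s₂ s₃ T hX := by
    obtain ⟨z₁, z₂, z₃, z₄, rfl⟩ : ∃ α β t₁ t₂, z = fromBlocks α β t₁ t₂ :=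
      ⟨_, _, _, _, (fromBlocks_toBlocks z).symm⟩
    obtain ⟨z₅, z₆, z₇, z₈, rfl⟩ : ∃ α β t₁ t₂, z₄ = fromBlocks α β t₁ t₂ :=
      ⟨_, _, _, _, (fromBlocks_toBlocks z₄).symm⟩
    obtain ⟨p₁, p₂, rfl⟩ : ∃ s₁ s₂, z₂ = fromCols s₁ s₂ := ⟨_, _, (fromCols_toCols z₂).symm⟩
    obtain ⟨r₁, r₂, rfl⟩ : ∃ s₁ s₂, z₃ = fromRows s₁ s₂ := ⟨_, _, (fromRows_toRows z₃).symm⟩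
    obtain ⟨q₁, q₂, rfl⟩ : ∃ s₁ s₂, q = fromCols s₁ s₂ := ⟨_, _, (fromCols_toCols q).symm⟩
    obtain ⟨q₂, q₃, rfl⟩ : ∃ s₁ s₂, q₂ = fromCols s₁ s₂ := ⟨_, _, (fromCols_toCols q₂).symm⟩
    obtain ⟨w₁, w₂, rfl⟩ : ∃ s₁ s₂, w = fromCols s₁ s₂ := ⟨_, _, (fromCols_toCols w).symm⟩
    obtain ⟨w₂, w₃, rfl⟩ : ∃ s₁ s₂, w₂ = fromCols s₁ s₂ := ⟨_, _, (fromCols_toCols w₂).symm⟩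
    simp only [fromBlocks_multiply, fromBlocks_mul_fromRows, fromRows_mul, fromCols_mul_fromRows,
      mul_fromCols, Matrix.mul_zero, Matrix.mul_one, Matrix.zero_mul,
      Matrix.one_mul, add_zero, zero_add] at hX
    have e31 : fromRows z₁ (fromRows r₁ r₂) = fromRows x (fromRows 0 0) := by
      ext i j
      have := congrFun (congrFun hX (.inr (.inr i))) (.inl j)
      rcases i with i | i | i <;> simpa [sub_eq_zero] using this
    have e32 : fromRows p₁ (fromRows z₅ z₇) = fromRows p (fromRows y 0) := by
      ext i j
      have := congrFun (congrFun hX (.inr (.inr i))) (.inr (.inl j))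
      rcases i with i | i | i <;> simpa [sub_eq_zero] using this
    simp only [fromRows_inj.eq_iff] at e31 e32
    obtain ⟨rfl, rfl, rfl⟩ := e31
    obtain ⟨rfl, rfl, rfl⟩ := e32
    have e11 : q₁ = 0 := by
      ext i j
      simpa using congrFun (congrFun hX (.inl i)) (.inl j)
    have e21 : w₁ = 0 := by
      ext i j
      simpa using congrFun (congrFun hX (.inr (.inl i))) (.inl j)
    have e22 : w₂ = T := by
      ext i j
      simpa using congrFun (congrFun hX (.inr (.inl i))) (.inr (.inl j))
    subst e11 e21 e22
    rw [fromRows_zero] at hX ⊢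
    have e33 : fromBlocks z₁ (fromCols p₁ p₂) 0 (fromBlocks z₅ z₆ 0 z₈) * F -
        F * fromBlocks z₁ (fromCols p₁ p₂) 0 (fromBlocks z₅ z₆ 0 z₈) =
          fromBlocks 0 (fromCols q₂ q₃) 0 (fromBlocks w₂ w₃ 0 0) := by
      ext i j
      have := congrFun (congrFun hX (.inr (.inr i))) (.inr (.inr j))
      simp only [fromBlocks_apply₂₂, Matrix.sub_apply, Matrix.add_apply] at this
      rw [Matrix.sub_apply, sub_eq_iff_eq_add.1 this]
      rcases i with i | i | i <;> rcases j with j | j | j <;> simp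
    obtain ⟨hT, hd⟩ := h.sol _ _ _ _ _ _ _ _ _ _ e33
    refine ⟨hT, fun u hu => ?_⟩
    obtain ⟨v, hv⟩ := hd u hu
    refine ⟨v, ?_⟩
    rw [hv, ← h.comm, sub_self] at e33
    have f1 : q₂ = 0 := by
      ext i j
      simpa using (congrFun (congrFun e33 (.inl i)) (.inr (.inl j))).symm
    have f2 : q₃ = 0 := by
      ext i j
      simpa using (congrFun (congrFun e33 (.inl i)) (.inr (.inr j))).symm
    have f3 : w₃ = 0 := by
      ext i j
      simpa using (congrFun (congrFun e33 (.inr (.inl i))) (.inr (.inr j))).symm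
    have f4 : z₁ = diagonal (Sum.elim u v ∘ α) := by
      ext i j
      simpa [diagonal_apply] using congrFun (congrFun hv (.inl i)) (.inl j)
    have f5 : p₁ = 0 := by
      ext i j
      simpa using congrFun (congrFun hv (.inl i)) (.inr (.inl j))
    rw [hv, f1, f2, f3, f4, f5, hT, hu]
    simp only [Sum.comp_elim, diagonal_sum_elim, fromCols_zero, Sum.elim_comp_inl]

/-- Dual to `IsMid.extend_right`: the new first block is projected onto `M ⊕ D`. -/
theorem IsMid.extend_left {F : Matrix (A ⊕ (M ⊕ D)) (A ⊕ (M ⊕ D)) ℂ} {α : A → M ⊕ Fin N}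
    {δ : D → M ⊕ Fin N} (h : IsMid A M D N F α δ) :
    IsMid (A ⊕ (M ⊕ D)) M D N
      (fromBlocks F 0 (fromRows (fromCols 0 (fromCols 1 0)) (fromCols 0 (fromCols 0 1))) 0)
      (Sum.elim α (Sum.elim Sum.inl δ)) δ where
  surj l := by
    rcases h.surj l with ⟨i, hi⟩ | ⟨i, hi⟩
    · exact Or.inl ⟨.inl i, hi⟩
    · exact Or.inr ⟨i, hi⟩
  comm u v := by
    have hc := h.comm u v
    simp only [Sum.comp_elim, diagonal_sum_elim] at hc
    simp only [Sum.comp_elim, diagonal_sum_elim, fromBlocks_multiply, fromRows_mul,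
      fromBlocks_mul_fromRows, fromCols_mul_fromBlocks, mul_fromCols, Matrix.mul_zero,
      Matrix.mul_one, Matrix.zero_mul,
      Matrix.one_mul, add_zero, zero_add, hc]
  sol x p q y w z s₁ s₂ s₃ T hX := by
    obtain ⟨x₁, x₂, x₃, x₄, rfl⟩ : ∃ α β t₁ t₂, x = fromBlocks α β t₁ t₂ :=
      ⟨_, _, _, _, (fromBlocks_toBlocks x).symm⟩
    obtain ⟨x₅, x₆, x₇, x₈, rfl⟩ : ∃ α β t₁ t₂, x₄ = fromBlocks α β t₁ t₂ :=
      ⟨_, _, _, _, (fromBlocks_toBlocks x₄).symm⟩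
    obtain ⟨x₂, x₉, rfl⟩ : ∃ s₁ s₂, x₂ = fromCols s₁ s₂ := ⟨_, _, (fromCols_toCols x₂).symm⟩
    obtain ⟨r₁, r₂, rfl⟩ : ∃ s₁ s₂, x₃ = fromRows s₁ s₂ := ⟨_, _, (fromRows_toRows x₃).symm⟩
    obtain ⟨p₁, p₂, rfl⟩ : ∃ s₁ s₂, p = fromRows s₁ s₂ := ⟨_, _, (fromRows_toRows p).symm⟩
    obtain ⟨p₂, p₃, rfl⟩ : ∃ s₁ s₂, p₂ = fromRows s₁ s₂ := ⟨_, _, (fromRows_toRows p₂).symm⟩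
    obtain ⟨q₁, q₂, rfl⟩ : ∃ s₁ s₂, q = fromRows s₁ s₂ := ⟨_, _, (fromRows_toRows q).symm⟩
    obtain ⟨q₂, q₃, rfl⟩ : ∃ s₁ s₂, q₂ = fromRows s₁ s₂ := ⟨_, _, (fromRows_toRows q₂).symm⟩
    simp only [fromBlocks_multiply, fromBlocks_mul_fromRows, fromRows_mul, fromCols_mul_fromRows,
      mul_fromCols, fromCols_mul_fromBlocks, Matrix.mul_zero, Matrix.mul_one, Matrix.zero_mul,
      Matrix.one_mul, add_zero, zero_add] at hX
    have e31 : fromCols r₁ (fromCols x₅ x₆) = fromCols 0 (fromCols y w) := by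
      ext i j
      have := congrFun (congrFun hX (.inr (.inl i))) (.inl j)
      rcases j with j | j | j <;> simpa [sub_eq_zero, eq_comm] using this
    have e32 : fromCols r₂ (fromCols x₇ x₈) = fromCols 0 (fromCols 0 z) := by
      ext i j
      have := congrFun (congrFun hX (.inr (.inr i))) (.inl j)
      rcases j with j | j | j <;> simpa [sub_eq_zero, eq_comm] using this
    simp only [fromCols_inj.eq_iff] at e31 e32
    obtain ⟨rfl, rfl, rfl⟩ := e31
    obtain ⟨rfl, rfl, rfl⟩ := e32
    have e22 : -p₂ = T := by
      ext i j
      simpa using congrFun (congrFun hX (.inr (.inl i))) (.inr (.inl j))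
    have e23 : p₃ = 0 := by
      ext i j
      simpa using congrFun (congrFun hX (.inr (.inr i))) (.inr (.inl j))
    have e33 : q₃ = 0 := by
      ext i j
      simpa using congrFun (congrFun hX (.inr (.inr i))) (.inr (.inr j))
    subst e22 e23 e33
    rw [fromRows_zero] at hX ⊢
    have e11 : fromBlocks x₁ (fromCols x₂ x₉) 0 (fromBlocks x₅ x₆ 0 x₈) * F -
        F * fromBlocks x₁ (fromCols x₂ x₉) 0 (fromBlocks x₅ x₆ 0 x₈) =
          fromBlocks 0 (fromCols (-p₁) (-q₁)) 0 (fromBlocks (-p₂) (-q₂) 0 0) := by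
      ext i j
      have := congrFun (congrFun hX (.inl i)) (.inl j)
      simp only [fromBlocks_apply₁₁, Matrix.sub_apply, Matrix.add_apply, Matrix.zero_apply] at this
      rw [Matrix.sub_apply, eq_neg_of_add_eq_zero_left
        ((add_sub_right_comm _ _ _).symm.trans this)]
      rcases i with i | i | i <;> rcases j with j | j | j <;> simp
    obtain ⟨hT, hd⟩ := h.sol _ _ _ _ _ _ _ _ _ _ e11
    refine ⟨hT, fun u hu => ?_⟩
    obtain ⟨v, hv⟩ := hd u hu
    refine ⟨v, ?_⟩
    rw [hv, ← h.comm, sub_self] at e11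
    have f1 : p₁ = 0 := by
      ext i j
      simpa using (congrFun (congrFun e11 (.inl i)) (.inr (.inl j))).symm
    have f2 : q₁ = 0 := by
      ext i j
      simpa using (congrFun (congrFun e11 (.inl i)) (.inr (.inr j))).symm
    have f3 : q₂ = 0 := by
      ext i j
      simpa using (congrFun (congrFun e11 (.inr (.inl i))) (.inr (.inr j))).symm
    have f4 : x₈ = diagonal (Sum.elim u v ∘ δ) := by
      ext i j
      simpa [diagonal_apply] using congrFun (congrFun hv (.inr (.inr i))) (.inr (.inr j))
    have f5 : x₆ = 0 := by
      ext i j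
      simpa using congrFun (congrFun hv (.inr (.inl i))) (.inr (.inr j))
    rw [hv, f1, f2, f3, f4, f5, neg_eq_zero.1 hT, hu]
    simp only [Sum.comp_elim, diagonal_sum_elim, fromCols_zero, fromRows_zero, Sum.elim_comp_inl]

/-- The Euclidean algorithm on `(a + m, m + d)`. -/
theorem exists_isMid (M : Type) [Fintype M] [DecidableEq M] (N : ℕ) :
    ∀ s a d : ℕ, a + d = s → 0 < a + Fintype.card M → 0 < Fintype.card M + d →
    Nat.gcd (a + Fintype.card M) (Fintype.card M + d) = Fintype.card M + N →
    ∃ (A D : Type) (_ : Fintype A) (_ : DecidableEq A) (_ : Fintype D) (_ : DecidableEq D),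
      Fintype.card A = a ∧ Fintype.card D = d ∧ ∃ F α δ, IsMid A M D N F α δ := by
  intro s
  induction s using Nat.strong_induction_on with
  | _ s ih =>
    intro a d hs ha hd hg
    rcases eq_or_ne a d with rfl | had
    · rw [add_comm (Fintype.card M) a, Nat.gcd_self] at hg
      obtain rfl : a = N := by omega
      exact ⟨Fin a, Fin a, inferInstance, inferInstance, inferInstance, inferInstance, by simp,
        by simp, _, _, _, isMid_base M a⟩
    · by_cases h1 : a + Fintype.card M ≤ d
      · obtain ⟨q, rfl⟩ := Nat.exists_eq_add_of_le' h1
        rw [← add_assoc, Nat.gcd_add_self_right] at hg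
        obtain ⟨A, D, _, _, _, _, hA, hD, F, α, δ, h⟩ :=
          ih (a + q) (by omega) a q rfl ha (by omega) hg
        exact ⟨A, A ⊕ (M ⊕ D), inferInstance, inferInstance, inferInstance, inferInstance, hA,
          by simp [hA, hD]; omega, _, _, _, h.extend_right⟩
      · by_cases h2 : Fintype.card M + d ≤ a
        · obtain ⟨q, rfl⟩ := Nat.exists_eq_add_of_le' h2
          rw [add_right_comm, Nat.gcd_add_self_left] at hg
          obtain ⟨A, D, _, _, _, _, hA, hD, F, α, δ, h⟩ :=
            ih (q + d) (by omega) q d rfl (by omega) hd hg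
          exact ⟨A ⊕ (M ⊕ D), D, inferInstance, inferInstance, inferInstance, inferInstance,
            by simp [hA, hD], hD, _, _, _, h.extend_left⟩
        -- Now `0 < |a - d| < |M|`, while the gcd `|M| + N` divides `a - d`.
        · exfalso
          have d1 := Nat.gcd_dvd_left (a + Fintype.card M) (Fintype.card M + d)
          have d2 := Nat.gcd_dvd_right (a + Fintype.card M) (Fintype.card M + d)
          rw [hg] at d1 d2
          rcases lt_or_gt_of_ne had with hlt | hlt
          · have := Nat.le_of_dvd (by omega) (Nat.dvd_sub d2 d1)
            omega
          · have := Nat.le_of_dvd (by omega) (Nat.dvd_sub d1 d2)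
            omega

end MidSteps

/-! ### Toral forms on parabolic subalgebras -/

/-- A matrix of type `(B, C)` whose symmetries are the diagonal matrices constant on the classes of
a colouring. -/
structure IsTwo (B C K : Type) [Fintype B] [DecidableEq B] [Fintype C] [DecidableEq C]
    (F : Matrix (B ⊕ C) (B ⊕ C) ℂ) (c : B ⊕ C → K) : Prop where
  surj : Function.Surjective c
  comm : ∀ v : K → ℂ, diagonal (v ∘ c) * F = F * diagonal (v ∘ c)
  sol : ∀ (x : Matrix B B ℂ) (p : Matrix B C ℂ) (z : Matrix C C ℂ) (s : Matrix B C ℂ),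
    fromBlocks x p 0 z * F - F * fromBlocks x p 0 z = fromBlocks 0 s 0 0 →
      ∃ v : K → ℂ, fromBlocks x p 0 z = diagonal (v ∘ c)

/-- The case of an empty middle block, in which all colours are free. -/
theorem exists_isTwo (b c : ℕ) (hb : 0 < b) (hc : 0 < c) :
    ∃ (B C K : Type) (_ : Fintype B) (_ : DecidableEq B) (_ : Fintype C) (_ : DecidableEq C)
      (_ : Fintype K), Fintype.card B = b ∧ Fintype.card C = c ∧ Fintype.card K = Nat.gcd b c ∧
      ∃ F γ, IsTwo B C K F γ := by
  obtain ⟨A, D, _, _, _, _, hA, hD, F, α, δ, h⟩ := exists_isMid (Fin 0) (Nat.gcd b c) _ b c rfl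
    (by simpa using hb) (by simpa using hc) (by simp)
  refine ⟨A, Fin 0 ⊕ D, Fin 0 ⊕ Fin (Nat.gcd b c), inferInstance, inferInstance, inferInstance,
    inferInstance, inferInstance, hA, by simp [hD], by simp, F,
    Sum.elim α (Sum.elim Sum.inl δ), ?_, ?_, ?_⟩
  · rintro (l | l)
    · exact l.elim0
    · rcases h.surj l with ⟨i, hi⟩ | ⟨i, hi⟩
      · exact ⟨.inl i, hi⟩
      · exact ⟨.inr (.inr i), hi⟩
  · intro v
    have := h.comm (v ∘ Sum.inl) (v ∘ Sum.inr)
    rwa [Sum.elim_comp_inl_inr] at this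
  · intro x p z s hX
    obtain ⟨z₁, z₂, z₃, z₄, rfl⟩ : ∃ α β t₁ t₂, z = fromBlocks α β t₁ t₂ :=
      ⟨_, _, _, _, (fromBlocks_toBlocks z).symm⟩
    obtain ⟨p₁, p₂, rfl⟩ : ∃ s₁ s₂, p = fromCols s₁ s₂ := ⟨_, _, (fromCols_toCols p).symm⟩
    obtain ⟨s₁, s₂, rfl⟩ : ∃ a b, s = fromCols a b := ⟨_, _, (fromCols_toCols s).symm⟩
    obtain rfl : z₃ = 0 := Subsingleton.elim _ _
    have h0 : (0 : Matrix (Fin 0 ⊕ D) (Fin 0 ⊕ D) ℂ) =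
      fromBlocks (0 : Matrix (Fin 0) (Fin 0) ℂ) (0 : Matrix (Fin 0) D ℂ) 0 0 := by simp
    rw [h0] at hX
    obtain ⟨v, hv⟩ := (h.sol _ _ _ _ _ _ _ _ _ _ hX).2 0 (Subsingleton.elim _ _)
    exact ⟨_, hv⟩

/-- A matrix whose symmetries in the block upper triangular matrices are the diagonal matrices
constant on the classes of a colouring. -/
structure IsToral {ι K : Type} [Fintype ι] [DecidableEq ι] (β : ι → ℕ) (c : ι → K)
    (A : Matrix ι ι ℂ) : Prop where
  surj : Function.Surjective c
  comm : ∀ v : K → ℂ, diagonal (v ∘ c) * A = A * diagonal (v ∘ c)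
  sol : ∀ x : Matrix ι ι ℂ, x.BlockTriangular β →
    (∀ i j, β i ≤ β j → (x * A - A * x) j i = 0) → ∃ v : K → ℂ, x = diagonal (v ∘ c)

/-- The existence of a toral form with a stabilizer of dimension `N` for the parabolic subalgebra
with the given list of block sizes. -/
def HasToralForm (l : List ℕ) (N : ℕ) : Prop :=
  ∃ (ι K : Type) (_ : Fintype ι) (_ : DecidableEq ι) (_ : Fintype K) (β : ι → ℕ) (c : ι → K)
    (A : Matrix ι ι ℂ), Fintype.card K = N ∧
      (∀ t, (∑ i, if β i = t then 1 else 0) = l.getD t 0) ∧ IsToral β c A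

theorem exists_equiv_of_card_fiber {α γ T : Type*} [Fintype α] [Fintype γ] [DecidableEq T]
    (f : α → T) (g : γ → T)
    (h : ∀ t, (∑ i, if f i = t then 1 else 0) = ∑ i, if g i = t then 1 else 0) :
    ∃ e : α ≃ γ, ∀ i, g (e i) = f i := by
  have h1 : ∀ t, Nonempty ({i // f i = t} ≃ {i // g i = t}) := by
    intro t
    refine ⟨Fintype.equivOfCardEq ?_⟩
    rw [Fintype.card_subtype, Fintype.card_subtype, Finset.card_filter, Finset.card_filter]
    exact h t
  have e := fun t => (h1 t).some
  refine ⟨(Equiv.sigmaFiberEquiv f).symm.trans ((Equiv.sigmaCongrRight e).trans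
    (Equiv.sigmaFiberEquiv g)), fun i => ?_⟩
  exact (e (f i) ⟨i, rfl⟩).2

theorem card_index_fiber {n : ℕ} (κ : Composition n) (t : ℕ) :
    (∑ i, if (κ.index i : ℕ) = t then 1 else 0) = κ.blocks.getD t 0 := by
  rw [← κ.blocksFinEquiv.sum_comp, Fintype.sum_sigma]
  have h1 : ∀ (i : Fin κ.length) (j : Fin (κ.blocksFun i)),
      κ.index (κ.blocksFinEquiv ⟨i, j⟩) = i := fun i j => κ.index_embedding i j
  simp only [h1, Finset.sum_ite_irrel, Finset.sum_const, Finset.card_univ, Fintype.card_fin,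
    smul_eq_mul, mul_one, mul_zero]
  by_cases ht : t < κ.length
  · rw [Finset.sum_eq_single ⟨t, ht⟩]
    · rw [if_pos rfl, List.getD_eq_getElem _ _ ht]
      rfl
    · intro i _ hi
      rw [if_neg fun h => hi (Fin.ext h)]
    · simp
  · rw [List.getD_eq_default _ _ (not_lt.1 ht)]
    refine Finset.sum_eq_zero fun i _ => ?_
    rw [if_neg]
    intro h
    exact ht (h ▸ i.2)

/-- Equal block sizes give a bijection of the index sets that respects the blocks, and the toral
form is transported along it. -/
theorem HasToralForm.lieIndex_eq {n : ℕ} {κ : Composition n} {N : ℕ}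
    (h : HasToralForm κ.blocks N) : lieIndex ℂ (parabolicSubalgebra κ) = N := by
  obtain ⟨ι, K, _, _, _, β, c, A, rfl, hcard, h⟩ := h
  obtain ⟨σ, hσ⟩ := exists_equiv_of_card_fiber β (fun i => (κ.index i : ℕ)) fun t => by
    rw [hcard, card_index_fiber]
  have hσ' : ∀ i, β (σ.symm i) = κ.index i := fun i => by
    rw [← hσ, σ.apply_symm_apply]
  have hmul : ∀ X Y : Matrix (Fin n) (Fin n) ℂ,
      (X * Y).submatrix σ σ = X.submatrix σ σ * Y.submatrix σ σ :=
    fun X Y => (submatrix_mul_equiv X Y σ σ σ).symm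
  have hA : (A.submatrix σ.symm σ.symm).submatrix σ σ = A := by
    ext i j; simp
  have hinj : ∀ X Y : Matrix (Fin n) (Fin n) ℂ, X.submatrix σ σ = Y.submatrix σ σ → X = Y := by
    intro X Y hXY
    ext i j
    simpa using congrFun (congrFun hXY (σ.symm i)) (σ.symm j)
  have hdiag : ∀ v : K → ℂ, (diagonal (v ∘ c ∘ σ.symm)).submatrix σ σ = diagonal (v ∘ c) := by
    intro v
    rw [submatrix_diagonal_equiv]
    congr 1
    ext i
    simp
  refine lieIndex_eq_card κ (c ∘ σ.symm) (h.surj.comp σ.symm.surjective)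
    (A.submatrix σ.symm σ.symm) ?_ ?_
  · intro v
    apply hinj
    rw [hmul, hmul, hA, hdiag, h.comm]
  · intro x hx hlow
    obtain ⟨v, hv⟩ := h.sol (x.submatrix σ σ) (by
      intro i j hij
      rw [← hσ, ← hσ] at hij
      exact hx hij) (by
      intro i j hij
      rw [← hσ i, ← hσ j] at hij
      have := hlow (σ i) (σ j) hij
      rw [← hA, ← hmul, ← hmul]
      exact this)
    refine ⟨v, hinj _ _ ?_⟩
    rw [hv, hdiag]

/-- Transposition together with reversal of the block order preserves block upper triangularity. -/
theorem HasToralForm.reverse {a b c d N : ℕ} (h : HasToralForm [a, b, c, d] N) :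
    HasToralForm [d, c, b, a] N := by
  obtain ⟨ι, K, _, _, _, β, γ, A, hK, hcard, h⟩ := h
  have hβ : ∀ i, β i ≤ 3 := by
    intro i
    by_contra hlt
    have h1 := hcard (β i)
    rw [List.getD_eq_default _ _ (by simp; omega), Finset.sum_eq_zero_iff] at h1
    simpa using h1 i (Finset.mem_univ i)
  have hlt : ∀ i j, 3 - β i ≤ 3 - β j ↔ β j ≤ β i := by
    intro i j
    have := hβ i
    have := hβ j
    omega
  refine ⟨ι, K, inferInstance, inferInstance, inferInstance, fun i => 3 - β i, γ, Aᵀ, hK, ?_,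
    h.surj, ?_, ?_⟩
  · intro t
    by_cases ht : t ≤ 3
    · have h1 : ∀ i, (3 - β i = t) = (β i = 3 - t) := fun i => by
        have := hβ i
        exact propext (by omega)
      simp only [h1, hcard]
      interval_cases t <;> rfl
    · rw [List.getD_eq_default _ _ (by simp; omega)]
      refine Finset.sum_eq_zero fun i _ => if_neg fun hi => ht ?_
      rw [← hi]
      exact Nat.sub_le 3 _
  · intro v
    have := congrArg transpose (h.comm v)
    rw [transpose_mul, transpose_mul, diagonal_transpose] at this
    exact this.symm
  · intro x hx hlow
    obtain ⟨v, hv⟩ := h.sol xᵀ (by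
      intro i j hij
      exact hx (not_le.1 fun h' => absurd ((hlt _ _).1 h') (not_le.2 hij))) (by
      intro i j hij
      have := hlow j i ((hlt _ _).2 hij)
      have e : xᵀ * A - A * xᵀ = -(x * Aᵀ - Aᵀ * x)ᵀ := by
        rw [transpose_sub, transpose_mul, transpose_mul, transpose_transpose, neg_sub]
      rw [e, Matrix.neg_apply, transpose_apply, this, neg_zero])
    refine ⟨v, ?_⟩
    rw [← transpose_transpose x, hv, diagonal_transpose]

/-! ### Assembling toral forms for four blocks -/

theorem sum_fiber_four (A B C D : Type) [Fintype A] [Fintype B] [Fintype C] [Fintype D] (t : ℕ) :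
    (∑ _i : A, if 0 = t then 1 else 0) + ((∑ _i : B, if 1 = t then 1 else 0) +
      ((∑ _i : C, if 2 = t then 1 else 0) + ∑ _i : D, if 3 = t then 1 else 0)) =
    [Fintype.card A, Fintype.card B, Fintype.card C, Fintype.card D].getD t 0 := by
  rcases t with _ | _ | _ | _ | t <;> simp

/-- A toral form from three blocks, the middle one of which is refined. -/
theorem hasToralForm_mid (a b c d : ℕ) (ha : 0 < a) (hb : 0 < b) (hc : 0 < c)
    (hg : b + c ≤ Nat.gcd (a + b + c) (b + c + d)) :
    HasToralForm [a, b, c, d] (Nat.gcd (a + b + c) (b + c + d) - (b + c) + Nat.gcd b c) := by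
  obtain ⟨N, hN⟩ := Nat.exists_eq_add_of_le hg
  obtain ⟨B, C, K, _, _, _, _, _, rfl, rfl, hK, Y, γ, hY⟩ := exists_isTwo b c hb hc
  obtain ⟨A, D, _, _, _, _, rfl, rfl, F, α, δ, h⟩ := exists_isMid (B ⊕ C) N _ a d rfl
    (by omega) (by rw [Fintype.card_sum]; omega) (by rw [Fintype.card_sum, ← add_assoc]; exact hN)
  refine ⟨A ⊕ ((B ⊕ C) ⊕ D), K ⊕ Fin N, inferInstance, inferInstance, inferInstance,
    Sum.elim (fun _ => 0) (Sum.elim (Sum.elim (fun _ => 1) (fun _ => 2)) fun _ => 3),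
    Sum.map γ id ∘ Sum.elim α (Sum.elim Sum.inl δ), F + fromBlocks 0 0 0 (fromBlocks Y 0 0 0),
    ?_, ?_, ?_, ?_, ?_⟩
  · rw [hN, Fintype.card_sum, hK, Fintype.card_fin]
    omega
  · intro t
    rw [← sum_fiber_four]
    simp only [Fintype.sum_sum_type, Sum.elim_inl, Sum.elim_inr, add_assoc]
    rfl
  · rintro (l | l)
    · obtain ⟨i, rfl⟩ := hY.surj l
      exact ⟨.inr (.inl i), rfl⟩
    · rcases h.surj l with ⟨i, hi⟩ | ⟨i, hi⟩
      · exact ⟨.inl i, by simp [hi]⟩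
      · exact ⟨.inr (.inr i), by simp [hi]⟩
  · intro v
    have h1 : v ∘ Sum.map γ id = Sum.elim (v ∘ Sum.inl ∘ γ) (v ∘ Sum.inr) := by
      ext (i | i) <;> rfl
    have h2 := hY.comm (v ∘ Sum.inl)
    rw [← Function.comp_assoc, h1, mul_add, add_mul, h.comm]
    congr 1
    simp only [Sum.comp_elim, Sum.elim_comp_inl, diagonal_sum_elim, fromBlocks_multiply]
    simpa [Function.comp_assoc] using h2
  · intro X hX hlow
    obtain ⟨x, r, x', y, rfl⟩ : ∃ α β t₁ t₂, X = fromBlocks α β t₁ t₂ :=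
      ⟨_, _, _, _, (fromBlocks_toBlocks X).symm⟩
    obtain ⟨p, q, rfl⟩ : ∃ s₁ s₂, r = fromCols s₁ s₂ := ⟨_, _, (fromCols_toCols r).symm⟩
    obtain ⟨y, w, y', z, rfl⟩ : ∃ α β t₁ t₂, y = fromBlocks α β t₁ t₂ :=
      ⟨_, _, _, _, (fromBlocks_toBlocks y).symm⟩
    obtain ⟨y₁, y₂, y₃, y₄, rfl⟩ : ∃ α β t₁ t₂, y = fromBlocks α β t₁ t₂ :=
      ⟨_, _, _, _, (fromBlocks_toBlocks y).symm⟩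
    obtain rfl : x' = 0 := by
      ext i j
      rcases i with (i | i) | i <;> exact hX (j := .inl j) (i := .inr _) (by simp)
    obtain rfl : y' = 0 := by
      ext i j
      rcases j with j | j <;> exact hX (j := .inr (.inl _)) (i := .inr (.inr i)) (by simp)
    obtain rfl : y₃ = 0 := by
      ext i j
      exact hX (j := .inr (.inl (.inl j))) (i := .inr (.inl (.inr i))) (by simp)
    set G := fromBlocks x (fromCols p q) 0 (fromBlocks (fromBlocks y₁ y₂ 0 y₄) w 0 z) * F -
      F * fromBlocks x (fromCols p q) 0 (fromBlocks (fromBlocks y₁ y₂ 0 y₄) w 0 z) with hG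
    have hsplit : ∀ P : Matrix (A ⊕ ((B ⊕ C) ⊕ D)) (A ⊕ ((B ⊕ C) ⊕ D)) ℂ,
        P * (F + fromBlocks 0 0 0 (fromBlocks Y 0 0 0)) -
          (F + fromBlocks 0 0 0 (fromBlocks Y 0 0 0)) * P = (P * F - F * P) +
          (P * fromBlocks 0 0 0 (fromBlocks Y 0 0 0) -
            fromBlocks 0 0 0 (fromBlocks Y 0 0 0) * P) := by
      intro P
      rw [mul_add, add_mul]
      abel
    rw [hsplit, ← hG] at hlow
    simp only [fromBlocks_multiply, fromCols_mul_fromBlocks, Matrix.mul_zero, Matrix.zero_mul,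
      add_zero, zero_add] at hlow
    -- Inserting `Y` changes the lower equations only at the middle block, which is the one that
    -- `IsMid` waives.
    have hGb : G = fromBlocks 0 (fromCols (G.toBlocks₁₂.toCols₁) (G.toBlocks₁₂.toCols₂)) 0
        (fromBlocks G.toBlocks₂₂.toBlocks₁₁ G.toBlocks₂₂.toBlocks₁₂ 0 0) := by
      ext i j
      have key := hlow j i
      rcases i with i | (i | i) | i <;> rcases j with j | (j | j) | j <;>
        first
        | rfl
        | simpa using key
    obtain ⟨hT, hd⟩ := h.sol _ _ _ _ _ _ _ _ _ _ hGb
    -- As `F` contributes nothing at the middle block, what is left there is the two-block problem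
    -- for `Y`.
    have hYeq : fromBlocks y₁ y₂ 0 y₄ * Y - Y * fromBlocks y₁ y₂ 0 y₄ = fromBlocks 0
        (fromBlocks y₁ y₂ 0 y₄ * Y - Y * fromBlocks y₁ y₂ 0 y₄).toBlocks₁₂ 0 0 := by
      ext i j
      have hGij : G (.inr (.inl i)) (.inr (.inl j)) = 0 := congrFun (congrFun hT i) j
      rcases i with i | i <;> rcases j with j | j <;>
        first
        | rfl
        | simpa [hGij] using hlow (.inr (.inl (.inl j))) (.inr (.inl (.inl i))) (by simp)
        | simpa [hGij] using hlow (.inr (.inl (.inl j))) (.inr (.inl (.inr i))) (by simp)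
        | simpa [hGij] using hlow (.inr (.inl (.inr j))) (.inr (.inl (.inr i))) (by simp)
    obtain ⟨v, hv⟩ := hY.sol _ _ _ _ hYeq
    obtain ⟨v', hv'⟩ := hd _ hv
    refine ⟨Sum.elim v v', ?_⟩
    rw [hv', ← Function.comp_assoc]
    congr 2
    ext (i | i) <;> rfl

/-- A toral form from three blocks, the first one of which is refined. -/
theorem hasToralForm_first (a b c d : ℕ) (ha : 0 < a) (hb : 0 < b) (hd : 0 < d)
    (hg : a + b ≤ Nat.gcd (a + b + c) (c + d)) :
    HasToralForm [a, b, c, d] (Nat.gcd (a + b + c) (c + d) - (a + b) + Nat.gcd a b) := by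
  obtain ⟨N, hN⟩ := Nat.exists_eq_add_of_le hg
  obtain ⟨B, C, K, _, _, _, _, _, rfl, rfl, hK, Y, γ, hY⟩ := exists_isTwo a b ha hb
  obtain ⟨R, D, _, _, _, _, rfl, rfl, k, f, δ, h⟩ := exists_isPair (B ⊕ C)
    (by rw [Fintype.card_sum]; omega) N c d hd (by rw [Fintype.card_sum]; exact hN)
  refine ⟨(B ⊕ C) ⊕ (R ⊕ D), K ⊕ Fin N, inferInstance, inferInstance, inferInstance,
    Sum.elim (Sum.elim (fun _ => 0) (fun _ => 1)) (Sum.elim (fun _ => 2) fun _ => 3),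
    Sum.elim (Sum.inl ∘ γ) (Sum.map γ id ∘ δ), fromBlocks Y 0 k f, ?_, ?_, ?_, ?_, ?_⟩
  · rw [hN, Fintype.card_sum, hK, Fintype.card_fin]
    omega
  · intro t
    rw [← sum_fiber_four]
    simp only [Fintype.sum_sum_type, Sum.elim_inl, Sum.elim_inr, add_assoc]
    rfl
  · rintro (l | l)
    · obtain ⟨i, rfl⟩ := hY.surj l
      exact ⟨.inl i, rfl⟩
    · obtain ⟨i, hi⟩ := h.surj l
      exact ⟨.inr i, by simp [hi]⟩
  · intro v
    have h1 : v ∘ Sum.map γ id = Sum.elim (v ∘ Sum.inl ∘ γ) (v ∘ Sum.inr) := by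
      ext (i | i) <;> rfl
    have h2 := hY.comm (v ∘ Sum.inl)
    rw [Sum.comp_elim, ← Function.comp_assoc v, ← Function.comp_assoc v, h1, diagonal_sum_elim,
      fromBlocks_multiply, fromBlocks_multiply, h.comm_k, h.comm_f, h2]
    simp [Function.comp_assoc]
  · intro X hX hlow
    obtain ⟨x, p, x', y, rfl⟩ : ∃ α β t₁ t₂, X = fromBlocks α β t₁ t₂ :=
      ⟨_, _, _, _, (fromBlocks_toBlocks X).symm⟩
    obtain ⟨x₁, x₂, x₃, x₄, rfl⟩ : ∃ α β t₁ t₂, x = fromBlocks α β t₁ t₂ :=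
      ⟨_, _, _, _, (fromBlocks_toBlocks x).symm⟩
    obtain ⟨t, w, t', z, rfl⟩ : ∃ α β t₁ t₂, y = fromBlocks α β t₁ t₂ :=
      ⟨_, _, _, _, (fromBlocks_toBlocks y).symm⟩
    obtain rfl : x' = 0 := by
      ext i j
      rcases i with i | i <;> rcases j with j | j <;>
        exact hX (j := .inl _) (i := .inr _) (by simp)
    obtain rfl : x₃ = 0 := by
      ext i j
      exact hX (j := .inl (.inl j)) (i := .inl (.inr i)) (by simp)
    obtain rfl : t' = 0 := by
      ext i j
      exact hX (j := .inr (.inl j)) (i := .inr (.inr i)) (by simp)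
    rw [fromBlocks_multiply, fromBlocks_multiply] at hlow
    simp only [Matrix.mul_zero, Matrix.zero_mul, add_zero, zero_add] at hlow
    have e21 : fromBlocks t w 0 z * k = k * fromBlocks x₁ x₂ 0 x₄ := by
      ext i j
      rcases i with i | i <;> rcases j with j | j <;>
        simpa [sub_eq_zero] using hlow (.inl _) (.inr _) (by simp)
    have e22 : fromBlocks t w 0 z * f - f * fromBlocks t w 0 z = k * p + fromBlocks 0
        (fromBlocks t w 0 z * f - f * fromBlocks t w 0 z - k * p).toBlocks₁₂ 0 0 := by
      ext i j
      rcases i with i | i <;> rcases j with j | j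
      · have := hlow (.inr (.inl j)) (.inr (.inl i)) (by simp)
        simp only [Matrix.sub_apply, Matrix.add_apply, fromBlocks_apply₂₂, fromBlocks_apply₁₁,
          Matrix.zero_apply] at this ⊢
        linear_combination this
      · simp [toBlocks₁₂]
      · have := hlow (.inr (.inl j)) (.inr (.inr i)) (by simp)
        simp only [Matrix.sub_apply, Matrix.add_apply, fromBlocks_apply₂₂, fromBlocks_apply₂₁,
          Matrix.zero_apply] at this ⊢
        linear_combination this
      · have := hlow (.inr (.inr j)) (.inr (.inr i)) (by simp)
        simp only [Matrix.sub_apply, Matrix.add_apply, fromBlocks_apply₂₂,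
          Matrix.zero_apply] at this ⊢
        linear_combination this
    -- Once `p * k` vanishes, the equation at the first two blocks involves `Y` alone.
    obtain ⟨hT, hd⟩ := h.sol _ _ _ _ _ _ e21 e22
    rw [hT, add_zero] at hlow
    have hYeq : fromBlocks x₁ x₂ 0 x₄ * Y - Y * fromBlocks x₁ x₂ 0 x₄ = fromBlocks 0
        (fromBlocks x₁ x₂ 0 x₄ * Y - Y * fromBlocks x₁ x₂ 0 x₄).toBlocks₁₂ 0 0 := by
      ext i j
      rcases i with i | i <;> rcases j with j | j
      · simpa using hlow (.inl (.inl j)) (.inl (.inl i)) (by simp)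
      · rfl
      · simpa using hlow (.inl (.inl j)) (.inl (.inr i)) (by simp)
      · simpa using hlow (.inl (.inr j)) (.inl (.inr i)) (by simp)
    obtain ⟨v, hv⟩ := hY.sol _ _ _ _ hYeq
    obtain ⟨rfl, v', hv'⟩ := hd _ hv
    refine ⟨Sum.elim v v', ?_⟩
    have hc : Sum.elim v v' ∘ Sum.map γ id = Sum.elim (v ∘ γ) v' := by
      ext (i | i) <;> rfl
    rw [hv', hv, Sum.comp_elim, diagonal_sum_elim, ← Function.comp_assoc, ← Function.comp_assoc,
      Sum.elim_comp_inl, hc]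

/-- A toral form from three blocks, the first one of which is cut out of the outer blocks. -/
theorem hasToralForm_outer (m b c d : ℕ) (hm : 0 < m) (hc : 0 < c) (hd : 0 < d)
    (hg : m ≤ Nat.gcd (m + b) (b + c)) :
    HasToralForm [m + d, b, c, d] (Nat.gcd (m + b) (b + c) - m + Nat.gcd m d) := by
  obtain ⟨N, hN⟩ := Nat.exists_eq_add_of_le hg
  obtain ⟨M, E, K, _, _, _, _, _, rfl, rfl, hK, Y, γ, hY⟩ := exists_isTwo m d hm hd
  obtain ⟨R, D, _, _, _, _, rfl, rfl, k, f, δ, h⟩ := exists_isPair M hm N b c hc hN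
  refine ⟨(M ⊕ E) ⊕ ((R ⊕ D) ⊕ E), K ⊕ Fin N, inferInstance, inferInstance, inferInstance,
    Sum.elim (fun _ => 0) (Sum.elim (Sum.elim (fun _ => 1) (fun _ => 2)) fun _ => 3),
    Sum.elim (Sum.inl ∘ γ) (Sum.elim (Sum.map (γ ∘ Sum.inl) id ∘ δ) (Sum.inl ∘ γ ∘ Sum.inr)),
    fromBlocks Y 0 (fromRows (fromCols k 0) (fromCols 0 1)) (fromBlocks f 0 0 0),
    ?_, ?_, ?_, ?_, ?_⟩
  · rw [hN, Fintype.card_sum, hK, Fintype.card_fin]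
    omega
  · intro t
    rw [← Fintype.card_sum, ← sum_fiber_four]
    simp only [Fintype.sum_sum_type, Sum.elim_inl, Sum.elim_inr, add_assoc]
    rfl
  · rintro (l | l)
    · obtain ⟨i, rfl⟩ := hY.surj l
      exact ⟨.inl i, rfl⟩
    · obtain ⟨i, hi⟩ := h.surj l
      exact ⟨.inr (.inl i), by simp [hi]⟩
  · intro v
    have h1 : v ∘ Sum.map (γ ∘ Sum.inl) id =
        Sum.elim (v ∘ Sum.inl ∘ γ ∘ Sum.inl) (v ∘ Sum.inr) := by
      ext (i | i) <;> rfl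
    have h2 := hY.comm (v ∘ Sum.inl)
    have h3 : v ∘ Sum.inl ∘ γ =
        Sum.elim (v ∘ Sum.inl ∘ γ ∘ Sum.inl) (v ∘ Sum.inl ∘ γ ∘ Sum.inr) := by
      ext (i | i) <;> rfl
    rw [Function.comp_assoc, h3] at h2
    rw [diagonal_sum_elim] at h2
    simp only [Sum.comp_elim, h3, ← Function.comp_assoc v (Sum.map _ _), h1, diagonal_sum_elim,
      fromBlocks_multiply, fromRows_mul, fromBlocks_mul_fromRows, fromCols_mul_fromBlocks,
      mul_fromCols, Matrix.mul_zero, Matrix.zero_mul, Matrix.mul_one, Matrix.one_mul, add_zero,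
      zero_add, h.comm_k, h.comm_f, h2]
  · intro X hX hlow
    obtain ⟨x, r, x', y, rfl⟩ : ∃ α β t₁ t₂, X = fromBlocks α β t₁ t₂ :=
      ⟨_, _, _, _, (fromBlocks_toBlocks X).symm⟩
    obtain ⟨p, q, rfl⟩ : ∃ s₁ s₂, r = fromCols s₁ s₂ := ⟨_, _, (fromCols_toCols r).symm⟩
    obtain ⟨p₁, p₂, rfl⟩ : ∃ s₁ s₂, p = fromRows s₁ s₂ := ⟨_, _, (fromRows_toRows p).symm⟩
    obtain ⟨q₁, q₂, rfl⟩ : ∃ s₁ s₂, q = fromRows s₁ s₂ := ⟨_, _, (fromRows_toRows q).symm⟩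
    obtain ⟨x₁, x₂, x₃, x₄, rfl⟩ : ∃ α β t₁ t₂, x = fromBlocks α β t₁ t₂ :=
      ⟨_, _, _, _, (fromBlocks_toBlocks x).symm⟩
    obtain ⟨y, w, y', z, rfl⟩ : ∃ α β t₁ t₂, y = fromBlocks α β t₁ t₂ :=
      ⟨_, _, _, _, (fromBlocks_toBlocks y).symm⟩
    obtain ⟨t, y₂, y₃, y₄, rfl⟩ : ∃ α β t₁ t₂, y = fromBlocks α β t₁ t₂ :=
      ⟨_, _, _, _, (fromBlocks_toBlocks y).symm⟩
    obtain rfl : x' = 0 := by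
      ext i j
      rcases i with (i | i) | i <;> exact hX (j := .inl j) (i := .inr _) (by simp)
    obtain rfl : y' = 0 := by
      ext i j
      rcases j with j | j <;> exact hX (j := .inr (.inl _)) (i := .inr (.inr i)) (by simp)
    obtain rfl : y₃ = 0 := by
      ext i j
      exact hX (j := .inr (.inl (.inl j))) (i := .inr (.inl (.inr i))) (by simp)
    rw [fromBlocks_multiply, fromBlocks_multiply] at hlow
    simp only [fromBlocks_mul_fromRows, fromRows_mul, fromCols_mul_fromRows, mul_fromCols,
      fromCols_mul_fromBlocks, fromBlocks_multiply, Matrix.mul_zero, Matrix.mul_one,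
      Matrix.zero_mul, Matrix.one_mul, add_zero, zero_add] at hlow
    -- The projection of the first block `M ⊕ E` onto the last block `E` makes `x` block upper
    -- triangular of type `(M, E)`, with `z` as its second diagonal block. Thus the undivided first
    -- block carries the two-block problem of sizes `m`, `d`.
    have e31 : fromCols x₃ x₄ = fromCols 0 z := by
      ext i j
      have := hlow (.inl j) (.inr (.inr i)) (by simp)
      rcases j with j | j <;> simpa [sub_eq_zero, eq_comm] using this
    obtain ⟨rfl, rfl⟩ := fromCols_inj.eq_iff.1 e31
    obtain rfl : p₂ = 0 := by
      ext i j
      have := hlow (.inr (.inl j)) (.inr (.inr i)) (by rcases j with j | j <;> simp)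
      simpa using this
    obtain rfl : q₂ = 0 := by
      ext i j
      simpa using hlow (.inr (.inr j)) (.inr (.inr i)) (by simp)
    have e21 : fromBlocks t y₂ 0 y₄ * k = k * x₁ := by
      ext i j
      simpa [sub_eq_zero] using hlow (.inl (.inl j)) (.inr (.inl i)) (by simp)
    have e21' : w = k * x₂ := by
      ext i j
      simpa [sub_eq_zero] using hlow (.inl (.inr j)) (.inr (.inl i)) (by simp)
    have e22 : fromBlocks t y₂ 0 y₄ * f - f * fromBlocks t y₂ 0 y₄ = k * p₁ + fromBlocks 0
        (fromBlocks t y₂ 0 y₄ * f - f * fromBlocks t y₂ 0 y₄ - k * p₁).toBlocks₁₂ 0 0 := by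
      ext i j
      have key := hlow (.inr (.inl j)) (.inr (.inl i))
      rcases i with i | i <;> rcases j with j | j
      · have := key (by simp)
        simp only [Matrix.sub_apply, Matrix.add_apply, fromBlocks_apply₂₂, fromBlocks_apply₁₁,
          fromCols_apply_inl, fromRows_apply_inl, Matrix.zero_apply] at this ⊢
        linear_combination this
      · simp [toBlocks₁₂]
      · have := key (by simp)
        simp only [Matrix.sub_apply, Matrix.add_apply, fromBlocks_apply₂₂, fromBlocks_apply₁₁,
          fromBlocks_apply₂₁, fromCols_apply_inl, fromRows_apply_inl, Matrix.zero_apply] at this ⊢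
        linear_combination this
      · have := key (by simp)
        simp only [Matrix.sub_apply, Matrix.add_apply, fromBlocks_apply₂₂, fromBlocks_apply₁₁,
          fromCols_apply_inl, fromRows_apply_inl, Matrix.zero_apply] at this ⊢
        linear_combination this
    obtain ⟨hT, hd⟩ := h.sol _ _ _ _ _ _ e21 e22
    -- The entry `q₁` of `X` from the last block to `M` supplies the free upper right term of the
    -- two-block problem.
    have hYeq : fromBlocks x₁ x₂ 0 x₄ * Y - Y * fromBlocks x₁ x₂ 0 x₄ =
        fromBlocks 0 (-q₁) 0 0 := by
      ext i j
      have key := hlow (.inl j) (.inl i) (by simp)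
      rw [hT, Matrix.zero_mul, fromRows_zero, fromCols_zero, zero_add] at key
      simp only [Matrix.sub_apply, Matrix.add_apply, fromBlocks_apply₁₁] at key
      rw [Matrix.sub_apply, eq_neg_of_add_eq_zero_left ((add_sub_right_comm _ _ _).symm.trans key)]
      rcases i with i | i <;> rcases j with j | j <;> simp
    obtain ⟨v, hv⟩ := hY.sol _ _ _ _ hYeq
    have hx₁ : x₁ = diagonal (v ∘ γ ∘ Sum.inl) := by
      ext i j
      simpa [diagonal_apply] using congrFun (congrFun hv (.inl i)) (.inl j)
    have hx₂ : x₂ = 0 := by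
      ext i j
      simpa using congrFun (congrFun hv (.inl i)) (.inr j)
    have hx₄ : x₄ = diagonal (v ∘ γ ∘ Sum.inr) := by
      ext i j
      simpa [diagonal_apply] using congrFun (congrFun hv (.inr i)) (.inr j)
    have hq₁ : q₁ = 0 := by
      rw [hv, hY.comm, sub_self] at hYeq
      ext i j
      simpa using (congrFun (congrFun hYeq (.inl i)) (.inr j)).symm
    obtain ⟨hp₁, v', hv'⟩ := hd _ hx₁
    have hc : Sum.elim v v' ∘ Sum.map (γ ∘ Sum.inl) id = Sum.elim (v ∘ γ ∘ Sum.inl) v' := by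
      ext (i | i) <;> rfl
    have hc' : Sum.elim v v' ∘ Sum.inl ∘ γ ∘ Sum.inr = v ∘ γ ∘ Sum.inr := rfl
    have hc'' : Sum.elim v v' ∘ Sum.inl ∘ γ = v ∘ γ := rfl
    refine ⟨Sum.elim v v', ?_⟩
    rw [hv, hv', e21', hx₂, hp₁, hq₁, hx₄, Matrix.mul_zero, fromRows_zero, fromRows_zero,
      fromCols_zero, Sum.comp_elim, Sum.comp_elim, diagonal_sum_elim, diagonal_sum_elim, hc', hc'',
      ← Function.comp_assoc (Sum.elim v v') (Sum.map _ _), hc]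

theorem mainTheorem5 (a b c d n : ℕ) (κ : Composition n) (hκ : κ.blocks = [a, b, c, d]) :
    (b + c ≤ Nat.gcd (a + b + c) (b + c + d) →
      lieIndex ℂ (parabolicSubalgebra κ) =
        Nat.gcd (a + b + c) (b + c + d) - (b + c) + Nat.gcd b c) ∧
    (a + b ≤ Nat.gcd (a + b + c) (c + d) →
      lieIndex ℂ (parabolicSubalgebra κ) =
        Nat.gcd (a + b + c) (c + d) - (a + b) + Nat.gcd a b) ∧
    (c + d ≤ Nat.gcd (a + b) (b + c + d) →
      lieIndex ℂ (parabolicSubalgebra κ) =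
        Nat.gcd (a + b) (b + c + d) - (c + d) + Nat.gcd c d) ∧
    (d < a → a - d ≤ Nat.gcd (b + a - d) (b + c) →
      lieIndex ℂ (parabolicSubalgebra κ) =
        Nat.gcd (b + a - d) (b + c) - (a - d) + Nat.gcd a d) := by
  have hpos : ∀ x ∈ [a, b, c, d], 0 < x := fun x hx => κ.blocks_pos (hκ ▸ hx)
  simp only [List.mem_cons, List.not_mem_nil, or_false, forall_eq_or_imp, forall_eq] at hpos
  obtain ⟨ha, hb, hc, hd⟩ := hpos
  refine ⟨fun h => ?_, fun h => ?_, fun h => ?_, fun hda h => ?_⟩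
  · refine HasToralForm.lieIndex_eq ?_
    rw [hκ]
    exact hasToralForm_mid a b c d ha hb hc h
  · refine HasToralForm.lieIndex_eq ?_
    rw [hκ]
    exact hasToralForm_first a b c d ha hb hd h
  -- The third case is the second one for the reversed composition `(d, c, b, a)`.
  · have e : Nat.gcd (d + c + b) (b + a) = Nat.gcd (a + b) (b + c + d) := by
      rw [Nat.gcd_comm, add_comm b a, add_comm d c, add_comm (c + d) b, add_assoc b]
    refine HasToralForm.lieIndex_eq ?_
    rw [hκ]
    have := (hasToralForm_first d c b a hd hc ha (by rw [e, add_comm]; exact h)).reverse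
    rwa [e, add_comm d c, Nat.gcd_comm d c] at this
  · obtain ⟨m, rfl⟩ := Nat.exists_eq_add_of_le' hda.le
    -- With `m = a - d`, both the hypothesis and the gcd of `a` and `d` are expressed through `m`,
    -- as in `hasToralForm_outer`.
    have e : b + (m + d) - d = m + b := by omega
    rw [e, Nat.add_sub_cancel] at h ⊢
    refine HasToralForm.lieIndex_eq ?_
    rw [hκ]
    have := hasToralForm_outer m b c d (by omega) hc hd h
    rwa [Nat.gcd_add_self_left]
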